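/- Let $T=(\mathbb C^*)^d$. A (complexified) toric arrangement $\mathcal A$ in $T$ is a finite set of hypertori $H=\{t\in T: t^{\chi}=a\}$, $\chi\in\mathbb Z^d\setminus\{0\}$, $|a|=1$, each given by its pair $(\chi,a)$. Its complement is $M(\mathcal A)=T\setminus\bigcup\mathcal A$, its rank is the dimension of the span of the vectors $\chi$, and its layers are the connected components of the intersections of hypertori of $\mathcal A$ (the empty intersection being $T$). For a real hyperplane arrangement $\mathcal H$, faces are the non-empty sets of points with a given sign vector, ordered by $G\le K$ iff $G\subseteq\overline K$; chambers are the faces on no hyperplane of $\mathcal H$. For a chamber $C$ and a face $G$, $C_G$ is the chamber $\ge G$ that no hyperplane containing $G$ separates from $C$. Let $\mathcal S(\mathcal H)$ be the poset of pairs $[G,C]$, $C$ a chamber, $G\le C$, with $[G',C']\le[G,C]$ iff $G\le G'$ and $C_{G'}=C'$. Let $\mathcal A^{\upharpoonright}$ be the $\mathbb Z^d$-periodic arrangement of the hyperplanes $\{x\in\mathbb R^d:\chi\cdot x=r\}$ with $(\chi,e^{2\pi i r})\in\mathcal A$, and $\mathcal A_0$ the arrangement of all linear hyperplanes $\chi^{\perp}$,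 $(\chi,a)\in\mathcal A$. The category $\mathcal F(\mathcal A)$ has as objects the $\mathbb Z^d$-orbits $F$ of faces of $\mathcal A^{\upharpoonright}$, each with a fixed representative $F^{\upharpoonright}$; a morphism $F\to G$ is a $u\in\mathbb Z^d$ with $F^{\upharpoonright}\le u+G^{\upharpoonright}$, and composition is addition. (If $\mathcal A$ is essential, i.e. of rank $d$, this is the face category of the induced cellularization of the compact torus.) Let $\mathcal A[F]$ be the linear arrangement of the hyperplanes parallel to those of $\mathcal A^{\upharpoonright}$ that contain $F^{\upharpoonright}$. A morphism $m=u:F\to G$ gives $i_m:\mathcal F(\mathcal A[G])\to\mathcal F(\mathcal A[F])$, where $i_m(K)$ has the signs of $K$ on $\mathcal A[G]$ and, on the rest of $\mathcal A[F]$, the signs of the vectors $y-x$ with $x\in F^{\upharpoonright}$, $y\in u+G^{\upharpoonright}$. Let $\mathscr D$ be the diagram on $\mathcal F(\mathcal A)^{op}$ with $\mathscr D(F)=\mathcal S(\mathcal A[F])$ and $\mathscr D(m)[K,C]=[i_m(K),i_m(C)]$. The Salvetti complex $\operatorname{Sal}(\mathcal A)$ is the geometric realization of the nerve of the Grothendieck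 construction $\int\mathscr D$, whose objects are written $(F,[G,C])$. Choose for each object a point $\xi(F,[G,C])=x+iy\in\mathbb C^d$ such that $x$ lies in the face of $\mathcal A^{\upharpoonright}$ adjacent to $F^{\upharpoonright}$ in the directions of $G$, and $y$ is on the same side as $C$ of each hyperplane of $\mathcal A[F]$ that contains $G$. The standard map $\operatorname{Sal}(\mathcal A)\to M(\mathcal A)$ for $\xi$ sends each simplex to the image under $z\mapsto (e^{2\pi i z_j})_j$ of the affine simplex in $\mathbb C^d$ spanned by the compatible $\mathbb Z^d$-translates of the points chosen for its vertices. For a layer $L$ let $X_L=\bigcap\{\chi^{\perp}: (\chi,a)\in\mathcal A,\ L\subseteq\{t^{\chi}=a\}\}\subseteq\mathbb R^d$. A face $F_0$ of $\mathcal A_0$ has support $L$ if its linear hull is $X_L$; then $\mathcal S_{L,F_0}\subseteq\operatorname{Sal}(\mathcal A)$ is the subcomplex given by the full subcategory of $\int\mathscr D$ on the objects $(F,[G,K])$ such that the image of $F$ in $T$ lies in $L$ and $K=C_G$ for some chamber $C$ of $\mathcal A[F]$ with $F_0\subseteq\overline C$. **Lemma.** Let $\mathcal A'\subseteq\mathcal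 A$ be a subarrangement of the same rank. There is a functor $\int\mathscr D(\mathcal A)\to\int\mathscr D(\mathcal A')$, sending each $(F,[G,C])$ to the object $(\widetilde F,[\widetilde G,\widetilde C])$ of cells of $\mathcal A'$ that contain $F$, $G$, $C$ respectively, with induced (cellular) map $\Psi:\operatorname{Sal}(\mathcal A)\to\operatorname{Sal}(\mathcal A')$, such that: 1. for all choices of points for $\mathcal A$ and for $\mathcal A'$, the composite $\operatorname{Sal}(\mathcal A)\to M(\mathcal A)\hookrightarrow M(\mathcal A')$ of the standard map and the inclusion is homotopic to the composite of $\Psi$ with the standard map $\operatorname{Sal}(\mathcal A')\to M(\mathcal A')$; 2. for every layer $L$ of $\mathcal A$ there is a smallest layer $\widetilde L$ of $\mathcal A'$ containing $L$; for every face $F$ of $\mathcal A_0$ with support $L$ there are faces $\widetilde F$ of $\mathcal A'_0$ with support $\widetilde L$ and $F\subseteq\overline{\widetilde F}$; and for every such $\widetilde F$ the functor restricts to a functor between the categories that define $\mathcal S_{L,F}$ and $\mathcal S_{\widetilde L,\widetilde F}$, so that $\Psi$ restricts to a map $\mathcal S_{L,F}\to\mathcal S_{\widetilde L,\widetilde F}$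 and the square with the inclusions commutes. -/

import Mathlib

open CategoryTheory

namespace ToricSal

/-! ## Real hyperplane arrangements and their Salvetti posets -/

/-- An affine form on `ℝ^d`, `h = (α, r)` standing for `x ↦ α · x - r`, together with the
hyperplane that it cuts out (when `α ≠ 0`) and with a choice of positive side. -/
abbrev Form (d : ℕ) : Type := (Fin d → ℝ) × ℝ

/-- An arrangement of affine hyperplanes in `ℝ^d`, each given by a defining form. Giving a
hyperplane several times changes none of the notions below. -/
abbrev Arr (d : ℕ) : Type := Set (Form d)

/-- The sign of `x` with respect to `h`: whether `x` is on `h`, or on which side it is. -/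
noncomputable def side {d : ℕ} (h : Form d) (x : Fin d → ℝ) : SignType :=
  SignType.sign (h.1 ⬝ᵥ x - h.2)

/-- All the points with the same sign vector as `x`. -/
def cell {d : ℕ} (ℋ : Arr d) (x : Fin d → ℝ) : Set (Fin d → ℝ) :=
  {y | ∀ h ∈ ℋ, side h y = side h x}

/-- The faces of an arrangement: the non-empty sets of all points with a fixed sign vector. -/
def Face {d : ℕ} (ℋ : Arr d) : Type :=
  {S : Set (Fin d → ℝ) // ∃ x, S = cell ℋ x}

/-- The set of points of a face. -/
def Face.carrier {d : ℕ} {ℋ : Arr d} (F : Face ℋ) : Set (Fin d → ℝ) := F.1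

/-- A point of a face. -/
noncomputable def Face.pt {d : ℕ} {ℋ : Arr d} (F : Face ℋ) : Fin d → ℝ := F.2.choose

/-- The sign vector of a face of `ℋ`; only its values at the elements of `ℋ` matter. -/
noncomputable def Face.sgn {d : ℕ} {ℋ : Arr d} (F : Face ℋ) (h : Form d) : SignType :=
  side h F.pt

/-- The face that contains a given point. -/
def Face.of {d : ℕ} (ℋ : Arr d) (x : Fin d → ℝ) : Face ℋ := ⟨cell ℋ x, x, rfl⟩

theorem Face.carrier_eq {d : ℕ} {ℋ : Arr d} (F : Face ℋ) : F.carrier = cell ℋ F.pt :=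
  F.2.choose_spec

theorem Face.pt_mem {d : ℕ} {ℋ : Arr d} (F : Face ℋ) : F.pt ∈ F.carrier := by
  rw [F.carrier_eq]; exact fun _ _ => rfl

theorem Face.mem_iff {d : ℕ} {ℋ : Arr d} (F : Face ℋ) (x : Fin d → ℝ) :
    x ∈ F.carrier ↔ ∀ h ∈ ℋ, side h x = F.sgn h := by
  rw [F.carrier_eq]; rfl

theorem Face.ext_sgn {d : ℕ} {ℋ : Arr d} {F G : Face ℋ}
    (e : ∀ h ∈ ℋ, F.sgn h = G.sgn h) : F = G := by
  apply Subtype.ext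
  change F.carrier = G.carrier
  ext x
  rw [F.mem_iff, G.mem_iff]
  exact forall₂_congr fun h hh => by rw [e h hh]

theorem Face.sgn_of {d : ℕ} {ℋ : Arr d} (x : Fin d → ℝ) {h : Form d} (hh : h ∈ ℋ) :
    (Face.of ℋ x).sgn h = side h x :=
  (((Face.of ℋ x).mem_iff x).1 (fun _ _ => rfl) h hh).symm

theorem side_convex {d : ℕ} {h : Form d} {x y : Fin d → ℝ} {ε : ℝ} (h0 : 0 < ε) (h1 : ε ≤ 1)
    (e : side h x = 0 ∨ side h x = side h y) : side h (x + ε • (y - x)) = side h y := by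
  have key : h.1 ⬝ᵥ (x + ε • (y - x)) - h.2 =
      (1 - ε) * (h.1 ⬝ᵥ x - h.2) + ε * (h.1 ⬝ᵥ y - h.2) := by
    simp only [dotProduct_add, dotProduct_smul, dotProduct_sub, smul_eq_mul]; ring
  simp only [side] at e ⊢
  rw [key]
  generalize h.1 ⬝ᵥ x - h.2 = a at *
  generalize h.1 ⬝ᵥ y - h.2 = b at *
  rcases e with e | e
  · rw [sign_eq_zero_iff] at e
    subst e
    simp [sign_mul, sign_pos h0]
  · rcases lt_trichotomy b 0 with hb | hb | hb
    · rw [sign_neg hb, sign_eq_neg_one_iff] at e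
      rw [sign_neg hb, sign_eq_neg_one_iff]
      nlinarith
    · subst hb
      rw [sign_zero, sign_eq_zero_iff] at e
      subst e; simp
    · rw [sign_pos hb, sign_eq_one_iff] at e
      rw [sign_pos hb, sign_eq_one_iff]
      nlinarith

theorem continuous_form {d : ℕ} (h : Form d) :
    Continuous fun x : Fin d → ℝ => h.1 ⬝ᵥ x - h.2 :=
  (continuous_const.dotProduct continuous_id).sub continuous_const

theorem Face.subset_closure_iff {d : ℕ} {ℋ : Arr d} (F G : Face ℋ) :
    F.carrier ⊆ closure G.carrier ↔ ∀ h ∈ ℋ, F.sgn h = 0 ∨ F.sgn h = G.sgn h := by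
  constructor
  · intro hFG h hh
    have hx := hFG F.pt_mem
    simp only [Face.sgn, side]
    rcases lt_trichotomy (h.1 ⬝ᵥ G.pt - h.2) 0 with hb | hb | hb
    · have : F.pt ∈ {x : Fin d → ℝ | h.1 ⬝ᵥ x - h.2 ≤ 0} := by
        refine closure_minimal ?_ (isClosed_le (continuous_form h) continuous_const) hx
        intro y hy
        have := (G.mem_iff y).1 hy h hh
        simp only [Face.sgn, side, sign_neg hb, sign_eq_neg_one_iff] at this
        exact this.le
      rcases (show h.1 ⬝ᵥ F.pt - h.2 ≤ 0 from this).lt_or_eq with h' | h'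
      · right; rw [sign_neg h', sign_neg hb]
      · left; rw [h', sign_zero]
    · have : F.pt ∈ {x : Fin d → ℝ | h.1 ⬝ᵥ x - h.2 = 0} := by
        refine closure_minimal ?_ (isClosed_eq (continuous_form h) continuous_const) hx
        intro y hy
        have := (G.mem_iff y).1 hy h hh
        simp only [Face.sgn, side, hb, sign_zero, sign_eq_zero_iff] at this
        exact this
      left; rw [show h.1 ⬝ᵥ F.pt - h.2 = 0 from this, sign_zero]
    · have : F.pt ∈ {x : Fin d → ℝ | 0 ≤ h.1 ⬝ᵥ x - h.2} := by
        refine closure_minimal ?_ (isClosed_le continuous_const (continuous_form h)) hx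
        intro y hy
        have := (G.mem_iff y).1 hy h hh
        simp only [Face.sgn, side, sign_pos hb, sign_eq_one_iff] at this
        exact this.le
      rcases (show 0 ≤ h.1 ⬝ᵥ F.pt - h.2 from this).lt_or_eq with h' | h'
      · right; rw [sign_pos h', sign_pos hb]
      · left; rw [← h', sign_zero]
  · intro e x hx
    have hlim : Filter.Tendsto (fun n : ℕ => x + (1 / ((n : ℝ) + 1)) • (G.pt - x)) Filter.atTop
        (nhds (x + (0 : ℝ) • (G.pt - x))) :=
      (tendsto_one_div_add_atTop_nhds_zero_nat.smul_const _).const_add _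
    rw [zero_smul, add_zero] at hlim
    refine mem_closure_of_tendsto hlim (Filter.Eventually.of_forall fun n => ?_)
    rw [G.mem_iff]
    intro h hh
    refine side_convex (by positivity) ?_ ?_
    · rw [div_le_one (by positivity)]; linarith [(Nat.cast_nonneg n : (0 : ℝ) ≤ n)]
    · rw [(F.mem_iff x).1 hx h hh]; exact e h hh

/-- The face poset: `F ≤ G` if `F` is contained in the closure of `G`. -/
instance {d : ℕ} (ℋ : Arr d) : PartialOrder (Face ℋ) where
  le F G := F.carrier ⊆ closure G.carrier
  le_refl _ := subset_closure
  le_trans _ _ _ h₁ h₂ := h₁.trans (closure_minimal h₂ isClosed_closure)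
  le_antisymm F G h₁ h₂ := by
    refine Face.ext_sgn fun h hh => ?_
    have e₁ := (F.subset_closure_iff G).1 h₁ h hh
    have e₂ := (G.subset_closure_iff F).1 h₂ h hh
    grind

theorem Face.le_iff {d : ℕ} {ℋ : Arr d} {F G : Face ℋ} :
    F ≤ G ↔ ∀ h ∈ ℋ, F.sgn h = 0 ∨ F.sgn h = G.sgn h :=
  F.subset_closure_iff G

/-- Chambers: the faces that lie on no hyperplane of the arrangement. -/
def Face.IsChamber {d : ℕ} {ℋ : Arr d} (C : Face ℋ) : Prop := ∀ h ∈ ℋ, C.sgn h ≠ 0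

/-- No hyperplane of the arrangement that contains `G` separates `C` from `C'`. For chambers
`C`, and `C'` with `G ≤ C'`, this says that `C' = C_G`. -/
def Face.NotSep {d : ℕ} {ℋ : Arr d} (G C C' : Face ℋ) : Prop :=
  ∀ h ∈ ℋ, G.sgn h = 0 → C.sgn h = C'.sgn h

/-- The elements `[G, C]` of the Salvetti poset. -/
@[ext]
structure SalPoset {d : ℕ} (ℋ : Arr d) : Type where
  face : Face ℋ
  chamber : Face ℋ
  isChamber : chamber.IsChamber
  le : face ≤ chamber

/-- `[G', C'] ≤ [G, C]` if `G ≤ G'` and `C_{G'} = C'`. -/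
instance {d : ℕ} (ℋ : Arr d) : PartialOrder (SalPoset ℋ) where
  le x y := y.face ≤ x.face ∧ x.face.NotSep y.chamber x.chamber
  le_refl x := ⟨le_refl _, fun _ _ _ => rfl⟩
  le_trans x y z h₁ h₂ := by
    refine ⟨h₂.1.trans h₁.1, fun h hh h0 => ?_⟩
    have : y.face.sgn h = 0 := by
      rcases Face.le_iff.1 h₁.1 h hh with e | e
      · exact e
      · rw [e, h0]
    exact (h₂.2 h hh this).trans (h₁.2 h hh h0)
  le_antisymm x y h₁ h₂ := by
    have e : x.face = y.face := le_antisymm h₂.1 h₁.1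
    refine SalPoset.ext e (Face.ext_sgn fun h hh => ?_)
    by_cases h0 : x.face.sgn h = 0
    · exact (h₁.2 h hh h0).symm
    · have a := (Face.le_iff.1 x.le h hh).resolve_left h0
      have b := (Face.le_iff.1 y.le h hh).resolve_left (e ▸ h0)
      rw [← a, ← b, e]

/-- The arrangement of linear hyperplanes parallel to the elements of `ℋ` through `F`. -/
def localArr {d : ℕ} (ℋ : Arr d) (F : Face ℋ) : Arr d :=
  {h | h.2 = 0 ∧ ∃ r : ℝ, (h.1, r) ∈ ℋ ∧ F.sgn (h.1, r) = 0}

/-! ## Toric arrangements -/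

/-- The complex torus `(ℂ^*)^d`. -/
abbrev Torus (d : ℕ) : Type := Fin d → ℂˣ

/-- The universal covering map `ℂ^d → (ℂ^*)^d`, `z ↦ (exp (2 π i z_j))_j`. -/
noncomputable def torusExp {d : ℕ} (z : Fin d → ℂ) : Torus d :=
  fun j => Units.mk0 (Complex.exp (2 * Real.pi * Complex.I * z j)) (Complex.exp_ne_zero _)

/-- The point `x + i y` of `ℂ^d`. -/
def cpt {d : ℕ} (x y : Fin d → ℝ) : Fin d → ℂ := fun j => (x j : ℂ) + (y j : ℂ) * Complex.I

/-- The real vector with the same entries as an integer vector. -/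
def castVec {d : ℕ} (u : Fin d → ℤ) : Fin d → ℝ := fun j => (u j : ℝ)

/-- The hypertorus `{t | t^χ = a}`. -/
def hypertorus {d : ℕ} (h : (Fin d → ℤ) × Circle) : Set (Torus d) :=
  {t | ((∏ j, t j ^ h.1 j : ℂˣ) : ℂ) = (h.2 : ℂ)}

/-- A (complexified) toric arrangement in `(ℂ^*)^d`: finitely many pairs `(χ, a)` of a character
`χ ≠ 0` and an `a` in the unit circle, standing for the hypertori `{t | t^χ = a}`. -/
structure ToricArrangement (d : ℕ) : Type where
  carrier : Set ((Fin d → ℤ) × Circle)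
  finite : carrier.Finite
  ne_zero : ∀ h ∈ carrier, h.1 ≠ 0

namespace ToricArrangement

variable {d : ℕ}

/-- The complement of the arrangement. -/
def compl (A : ToricArrangement d) : Set (Torus d) := {t | ∀ h ∈ A.carrier, t ∉ hypertorus h}

/-- The rank of the arrangement. -/
noncomputable def rank (A : ToricArrangement d) : ℕ :=
  Module.finrank ℝ (Submodule.span ℝ {v : Fin d → ℝ | ∃ h ∈ A.carrier, v = castVec h.1})

/-- Layers: connected components of intersections of hypertori of the arrangement. -/
def IsLayer (A : ToricArrangement d) (L : Set (Torus d)) : Prop :=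
  ∃ B ⊆ A.carrier, ∃ t ∈ ⋂ h ∈ B, hypertorus h,
    L = connectedComponentIn (⋂ h ∈ B, hypertorus h) t

/-- The subspace `X_L`: the intersection of the linear hyperplanes parallel to the hypertori
that contain `L`. -/
def dirSpace (A : ToricArrangement d) (L : Set (Torus d)) : Set (Fin d → ℝ) :=
  {v | ∀ h ∈ A.carrier, L ⊆ hypertorus h → castVec h.1 ⬝ᵥ v = 0}

/-- The arrangement of all linear hyperplanes parallel to the hypertori of `A`. -/
def linArr (A : ToricArrangement d) : Arr d := {f | f.2 = 0 ∧ ∃ h ∈ A.carrier, f.1 = castVec h.1}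

/-- The periodic arrangement in `ℝ^d` that lifts `A`. -/
noncomputable def lift (A : ToricArrangement d) : Arr d :=
  {f | ∃ χ : Fin d → ℤ, f.1 = castVec χ ∧ (χ, Circle.exp (2 * Real.pi * f.2)) ∈ A.carrier}

theorem shift_mem (A : ToricArrangement d) {h : Form d} (hh : h ∈ A.lift) (u : Fin d → ℤ) :
    (h.1, h.2 - h.1 ⬝ᵥ castVec u) ∈ A.lift := by
  obtain ⟨χ, h1, h2⟩ := hh
  refine ⟨χ, h1, ?_⟩
  have e : h.1 ⬝ᵥ castVec u = ((χ ⬝ᵥ u : ℤ) : ℝ) := by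
    rw [h1]; simp [dotProduct, castVec]
  have : Circle.exp (2 * Real.pi * (h.2 - h.1 ⬝ᵥ castVec u)) = Circle.exp (2 * Real.pi * h.2) := by
    rw [Circle.exp_eq_exp]
    refine ⟨-(χ ⬝ᵥ u), ?_⟩
    rw [e]; push_cast; ring
  simpa only [this] using h2

theorem side_add (h : Form d) (x : Fin d → ℝ) (u : Fin d → ℤ) :
    side h (x + castVec u) = side (h.1, h.2 - h.1 ⬝ᵥ castVec u) x := by
  simp only [side, dotProduct_add]
  congr 1; ring

theorem castVec_add (u v : Fin d → ℤ) : castVec (u + v) = castVec u + castVec v := by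
  ext j; simp [castVec]

theorem castVec_zero : castVec (0 : Fin d → ℤ) = 0 := by
  ext j; simp [castVec]

/-- The translate `F + u` of a face of the periodic arrangement by `u ∈ ℤ^d`. -/
noncomputable def translate (A : ToricArrangement d) (u : Fin d → ℤ) (F : Face A.lift) :
    Face A.lift :=
  Face.of A.lift (F.pt + castVec u)

theorem translate_sgn (A : ToricArrangement d) (u : Fin d → ℤ) (F : Face A.lift) {h : Form d}
    (hh : h ∈ A.lift) :
    (A.translate u F).sgn h = F.sgn (h.1, h.2 - h.1 ⬝ᵥ castVec u) := by
  rw [translate, Face.sgn_of _ hh, side_add]; rfl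

theorem mem_translate (A : ToricArrangement d) (u : Fin d → ℤ) (F : Face A.lift)
    (x : Fin d → ℝ) : x ∈ (A.translate u F).carrier ↔ x - castVec u ∈ F.carrier := by
  have key (h : Form d) : side h x = side (h.1, h.2 - h.1 ⬝ᵥ castVec u) (x - castVec u) := by
    rw [← side_add, sub_add_cancel]
  rw [Face.mem_iff, Face.mem_iff]
  constructor
  · intro H h hh
    have hm : (h.1, h.2 + h.1 ⬝ᵥ castVec u) ∈ A.lift := by
      have := A.shift_mem hh (-u)
      have e : castVec (-u) = -castVec u := by ext j; simp [castVec]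
      simpa [e] using this
    have := H _ hm
    rw [translate_sgn _ _ _ hm, key] at this
    simpa using this
  · intro H h hh
    rw [translate_sgn _ _ _ hh, key]
    exact H _ (A.shift_mem hh u)

theorem translate_zero (A : ToricArrangement d) (F : Face A.lift) : A.translate 0 F = F :=
  Face.ext_sgn fun h hh => by rw [translate_sgn _ _ _ hh, castVec_zero]; simp

theorem translate_add (A : ToricArrangement d) (u v : Fin d → ℤ) (F : Face A.lift) :
    A.translate (u + v) F = A.translate u (A.translate v F) :=
  Face.ext_sgn fun h hh => by
    rw [translate_sgn _ _ _ hh, translate_sgn _ _ _ hh, translate_sgn _ _ _ (A.shift_mem hh u),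
      castVec_add]
    simp only [dotProduct_add]
    congr 2; ring

theorem translate_mono (A : ToricArrangement d) (u : Fin d → ℤ) {F G : Face A.lift}
    (h : F ≤ G) : A.translate u F ≤ A.translate u G :=
  Face.le_iff.2 fun f hf => by
    rw [translate_sgn _ _ _ hf, translate_sgn _ _ _ hf]
    exact Face.le_iff.1 h _ (A.shift_mem hf u)

/-- Faces of the lifted arrangement are identified when they differ by a translation in `ℤ^d`. -/
def faceSetoid (A : ToricArrangement d) : Setoid (Face A.lift) where
  r F G := ∃ u, F = A.translate u G
  iseqv :=
    { refl := fun F => ⟨0, (A.translate_zero F).symm⟩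
      symm := by
        rintro F G ⟨u, rfl⟩
        exact ⟨-u, by rw [← translate_add, neg_add_cancel, translate_zero]⟩
      trans := by
        rintro F G H ⟨u, rfl⟩ ⟨v, rfl⟩
        exact ⟨u + v, (A.translate_add u v H).symm⟩ }

/-- The faces of the stratification of the compact torus `ℝ^d / ℤ^d` induced by `A`. -/
def ToricFace (A : ToricArrangement d) : Type := Quotient A.faceSetoid

/-- A lift of a toric face to `ℝ^d`. -/
noncomputable def ToricFace.rep {A : ToricArrangement d} (F : A.ToricFace) : Face A.lift :=
  Quotient.out F

/-- The points of the (compact) torus that lie on the toric face `F`. -/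
noncomputable def ToricFace.points {A : ToricArrangement d} (F : A.ToricFace) : Set (Torus d) :=
  {t | ∃ x ∈ F.rep.carrier, t = torusExp (cpt x 0)}

/-- The face category `ℱ(A)`. A morphism `F ⟶ G` is a translate of the lift of `G` having the
lift of `F` in its closure; in other words, a face of the (closed) lift of `G` over `F`. When
`A` is essential, `ℤ^d` acts freely and this is the quotient by `ℤ^d` of the poset of faces of the
lifted arrangement, that is, the acyclic category of the cellularization of the compact torus.
When `A` is not essential, translations that fix a lift also count as morphisms. -/
instance (A : ToricArrangement d) : SmallCategory A.ToricFace where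
  Hom F G := {u : Fin d → ℤ // F.rep ≤ A.translate u G.rep}
  id F := ⟨0, (A.translate_zero F.rep).ge⟩
  comp {F G H} m n := ⟨m.1 + n.1, by
    rw [translate_add]; exact m.2.trans (A.translate_mono _ n.2)⟩
  id_comp _ := Subtype.ext (zero_add _)
  comp_id _ := Subtype.ext (add_zero _)
  assoc _ _ _ := Subtype.ext (add_assoc _ _ _)

/-- The local linear arrangement `A[F]` at a face `F`. -/
noncomputable def loc (A : ToricArrangement d) (F : A.ToricFace) : Arr d :=
  localArr A.lift F.rep

/-- For `m : F ⟶ G`, a vector pointing from `F` into the copy of `G` given by `m`; the face `F_m`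
of `A[F]` is the one that contains it. -/
noncomputable def dir {A : ToricArrangement d} {F G : A.ToricFace} (m : F ⟶ G) : Fin d → ℝ :=
  G.rep.pt + castVec m.1 - F.rep.pt

section faceMap

variable {A : ToricArrangement d} {F G : A.ToricFace}

theorem loc_zero {h : Form d} (hh : h ∈ A.loc F) : h.2 = 0 := hh.1

theorem side_zero_iff (h : Form d) (x : Fin d → ℝ) : side h x = 0 ↔ h.1 ⬝ᵥ x = h.2 := by
  rw [side, sign_eq_zero_iff, sub_eq_zero]

/-- `A[G] ⊆ A[F]`, and the elements of `A[G]` vanish on `F_m`. -/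
theorem loc_sub (m : F ⟶ G) {h : Form d} (hh : h ∈ A.loc G) :
    h ∈ A.loc F ∧ side h (dir m) = 0 := by
  obtain ⟨h0, r, hr, hs⟩ := hh
  have hm : (h.1, r + h.1 ⬝ᵥ castVec m.1) ∈ A.lift := by
    have := A.shift_mem hr (-m.1)
    have e : castVec (-m.1) = -castVec m.1 := by ext j; simp [castVec]
    simpa [e] using this
  have hz : (A.translate m.1 G.rep).sgn (h.1, r + h.1 ⬝ᵥ castVec m.1) = 0 := by
    rw [translate_sgn _ _ _ hm]; simpa using hs
  have hF : F.rep.sgn (h.1, r + h.1 ⬝ᵥ castVec m.1) = 0 := by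
    rcases Face.le_iff.1 m.2 _ hm with e | e
    · exact e
    · rw [e, hz]
  refine ⟨⟨h0, _, hm, hF⟩, ?_⟩
  have e1 := (side_zero_iff _ _).1 hs
  have e2 := (side_zero_iff _ _).1 hF
  rw [side_zero_iff, h0, dir, dotProduct_sub, dotProduct_add]
  simp only at e1 e2
  rw [e1, e2]; ring

theorem side_dir (m : F ⟶ G) {h : Form d} {r : ℝ} (h0 : h.2 = 0)
    (hF : F.rep.sgn (h.1, r) = 0) (hr : (h.1, r) ∈ A.lift) :
    side h (dir m) = (A.translate m.1 G.rep).sgn (h.1, r) := by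
  have e2 := (side_zero_iff _ _).1 hF
  rw [translate_sgn _ _ _ hr]
  simp only [side, Face.sgn, dir, dotProduct_sub, dotProduct_add, h0] at e2 ⊢
  congr 1; rw [e2]; ring

theorem side_dir_ne (m : F ⟶ G) {h : Form d} (hF : h ∈ A.loc F) (hG : h ∉ A.loc G) :
    side h (dir m) ≠ 0 := by
  obtain ⟨h0, r, hr, hs⟩ := hF
  rw [side_dir m h0 hs hr, translate_sgn _ _ _ hr]
  exact fun e => hG ⟨h0, _, A.shift_mem hr m.1, e⟩

theorem loc_finite (A : ToricArrangement d) (F : A.ToricFace) : (A.loc F).Finite := by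
  refine (A.finite.image fun h => ((castVec h.1, 0) : Form d)).subset ?_
  rintro h ⟨h0, r, ⟨χ, hχ, hm⟩, -⟩
  exact ⟨_, hm, Prod.ext hχ.symm h0.symm⟩

theorem eventually_side (h : Form d) (w k : Fin d → ℝ) (hw : side h w ≠ 0) :
    ∀ᶠ ε in nhdsWithin (0 : ℝ) (Set.Ioi 0), side h (w + ε • k) = side h w := by
  have hc : Continuous fun ε : ℝ => h.1 ⬝ᵥ (w + ε • k) - h.2 :=
    (continuous_form h).comp (by fun_prop)
  have ht := (hc.tendsto 0).mono_left (nhdsWithin_le_nhds (s := Set.Ioi (0 : ℝ)))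
  simp only [zero_smul, add_zero] at ht
  simp only [side] at hw ⊢
  rcases lt_trichotomy (h.1 ⬝ᵥ w - h.2) 0 with hb | hb | hb
  · filter_upwards [ht.eventually_lt_const hb] with ε hε
    rw [sign_neg hε, sign_neg hb]
  · exact absurd (by rw [hb, sign_zero]) hw
  · filter_upwards [ht.eventually_const_lt hb] with ε hε
    rw [sign_pos hε, sign_pos hb]

theorem exists_faceMap (m : F ⟶ G) (K : Face (A.loc G)) : ∃ v : Fin d → ℝ, ∀ h ∈ A.loc F,
    (h ∈ A.loc G → side h v = K.sgn h) ∧ (h ∉ A.loc G → side h v = side h (dir m)) := by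
  have ev : ∀ᶠ ε in nhdsWithin (0 : ℝ) (Set.Ioi 0), ∀ h ∈ A.loc F,
      h ∉ A.loc G → side h (dir m + ε • K.pt) = side h (dir m) := by
    refine (Filter.eventually_all_finite (A.loc_finite F)).2 fun h hF => ?_
    by_cases hG : h ∈ A.loc G
    · exact Filter.Eventually.of_forall fun _ hn => absurd hG hn
    · exact (eventually_side h _ K.pt (side_dir_ne m hF hG)).mono fun _ e _ => e
  obtain ⟨ε, hε, h0⟩ := (ev.and self_mem_nhdsWithin).exists
  refine ⟨dir m + ε • K.pt, fun h hF => ⟨fun hG => ?_, hε h hF⟩⟩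
  have e := (side_zero_iff _ _).1 (loc_sub m hG).2
  have h2 := loc_zero hG
  simp only [Face.sgn, side, dotProduct_add, dotProduct_smul, e, h2, smul_eq_mul]
  rw [zero_add, sub_zero, sub_zero, sign_mul, sign_pos (show 0 < ε from h0), one_mul]

/-- The inclusion `i_m : ℱ(A[G]) → ℱ(A[F])` for `m : F ⟶ G`: the face `i_m(K)` has the signs of
`K` on `A[G]`, and the signs of `F_m` on the other elements of `A[F]`. -/
noncomputable def faceMap (m : F ⟶ G) (K : Face (A.loc G)) : Face (A.loc F) :=
  Face.of (A.loc F) (exists_faceMap m K).choose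

theorem faceMap_sgn (m : F ⟶ G) (K : Face (A.loc G)) {h : Form d} (hG : h ∈ A.loc G) :
    (faceMap m K).sgn h = K.sgn h := by
  have hF := (loc_sub m hG).1
  rw [faceMap, Face.sgn_of _ hF]
  exact ((exists_faceMap m K).choose_spec h hF).1 hG

theorem faceMap_sgn' (m : F ⟶ G) (K : Face (A.loc G)) {h : Form d} (hF : h ∈ A.loc F)
    (hG : h ∉ A.loc G) : (faceMap m K).sgn h = side h (dir m) := by
  rw [faceMap, Face.sgn_of _ hF]
  exact ((exists_faceMap m K).choose_spec h hF).2 hG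

theorem faceMap_mono (m : F ⟶ G) {K K' : Face (A.loc G)} (hK : K ≤ K') :
    faceMap m K ≤ faceMap m K' :=
  Face.le_iff.2 fun h hF => by
    by_cases hG : h ∈ A.loc G
    · rw [faceMap_sgn m K hG, faceMap_sgn m K' hG]; exact Face.le_iff.1 hK h hG
    · rw [faceMap_sgn' m K hF hG, faceMap_sgn' m K' hF hG]; exact Or.inr rfl

/-- The map `[K, C] ↦ [i_m(K), i_m(C)]`. -/
noncomputable def salMap (m : F ⟶ G) (x : SalPoset (A.loc G)) : SalPoset (A.loc F) where
  face := faceMap m x.face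
  chamber := faceMap m x.chamber
  isChamber h hF := by
    by_cases hG : h ∈ A.loc G
    · rw [faceMap_sgn m _ hG]; exact x.isChamber h hG
    · rw [faceMap_sgn' m _ hF hG]; exact side_dir_ne m hF hG
  le := faceMap_mono m x.le

theorem salMap_mono (m : F ⟶ G) : Monotone (salMap m) := by
  intro x y hxy
  refine ⟨faceMap_mono m hxy.1, fun h hF h0 => ?_⟩
  change (faceMap m x.face).sgn h = 0 at h0
  change (faceMap m y.chamber).sgn h = (faceMap m x.chamber).sgn h
  by_cases hG : h ∈ A.loc G
  · rw [faceMap_sgn m _ hG] at h0 ⊢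
    rw [faceMap_sgn m _ hG]
    exact hxy.2 h hG h0
  · rw [faceMap_sgn' m _ hF hG, faceMap_sgn' m _ hF hG]

theorem faceMap_id (F : A.ToricFace) (K : Face (A.loc F)) : faceMap (𝟙 F) K = K :=
  Face.ext_sgn fun _ hh => faceMap_sgn _ _ hh

theorem faceMap_comp {F G H : A.ToricFace} (m : F ⟶ G) (n : G ⟶ H) (K : Face (A.loc H)) :
    faceMap (m ≫ n) K = faceMap m (faceMap n K) := by
  refine Face.ext_sgn fun h hF => ?_
  by_cases hH : h ∈ A.loc H
  · rw [faceMap_sgn _ _ hH, faceMap_sgn m _ (loc_sub n hH).1, faceMap_sgn n _ hH]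
  by_cases hG : h ∈ A.loc G
  · rw [faceMap_sgn' _ _ hF hH, faceMap_sgn m _ hG, faceMap_sgn' n _ hG hH]
    have e := (side_zero_iff _ _).1 (loc_sub m hG).2
    have : dir (m ≫ n) = dir n + dir m := by
      change H.rep.pt + castVec (m.1 + n.1) - F.rep.pt = _
      rw [castVec_add, dir, dir]; abel
    rw [this, side, side, dotProduct_add, e, loc_zero hF, add_zero]
  · rw [faceMap_sgn' _ _ hF hH, faceMap_sgn' m _ hF hG]
    obtain ⟨h0, r, hr, hs⟩ := hF
    rw [side_dir _ h0 hs hr, side_dir _ h0 hs hr]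
    have hle : A.translate m.1 G.rep ≤ A.translate (m ≫ n).1 H.rep := by
      change _ ≤ A.translate (m.1 + n.1) H.rep
      rw [translate_add]; exact A.translate_mono _ n.2
    rcases Face.le_iff.1 hle _ hr with e | e
    · exact absurd (by rw [side_dir m h0 hs hr, e]) (side_dir_ne m ⟨h0, r, hr, hs⟩ hG)
    · exact e.symm

end faceMap

/-- The diagram `𝒟` of posets on `ℱ(A)ᵒᵖ`, `F ↦ 𝒮(A[F])`. -/
noncomputable def diagram (A : ToricArrangement d) : A.ToricFaceᵒᵖ ⥤ Cat.{0, 0} where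
  obj F := Cat.of (SalPoset (A.loc F.unop))
  map m := (salMap_mono m.unop).functor.toCatHom
  map_id F := by
    apply Cat.ext
    refine CategoryTheory.Functor.ext (fun x => ?_)
      (fun x y _ => (Preorder.subsingleton_hom (α := SalPoset _) _ _).elim _ _)
    exact SalPoset.ext (faceMap_id _ _) (faceMap_id _ _)
  map_comp m n := by
    apply Cat.ext
    refine CategoryTheory.Functor.ext (fun x => ?_)
      (fun x y _ => (Preorder.subsingleton_hom (α := SalPoset _) _ _).elim _ _)
    exact SalPoset.ext (faceMap_comp _ _ _) (faceMap_comp _ _ _)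

/-- The Salvetti category `∫ 𝒟`; its objects are written `(F, [G, C])`. -/
abbrev SalCat (A : ToricArrangement d) : Type := Grothendieck A.diagram

/-- The face `F` of an object `(F, [G, C])`. -/
def base {A : ToricArrangement d} (x : A.SalCat) : A.ToricFace := x.base.unop

/-- The element `[G, C]` of `𝒮(A[F])` of an object `(F, [G, C])`. -/
def fib {A : ToricArrangement d} (x : A.SalCat) : SalPoset (A.loc (base x)) := x.fiber

/-- The translation vector of the morphism of faces underlying a morphism of `∫ 𝒟`. -/
def trans {A : ToricArrangement d} {x y : A.SalCat} (f : x ⟶ y) : Fin d → ℤ := f.base.unop.1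

theorem trans_comp {A : ToricArrangement d} {x y z : A.SalCat} (f : x ⟶ y) (g : y ⟶ z) :
    trans (f ≫ g) = trans g + trans f := rfl

/-- The toric Salvetti complex: the geometric realization of the nerve of `∫ 𝒟`. -/
noncomputable abbrev Sal (A : ToricArrangement d) : TopCat.{0} := SSet.toTop.obj (nerve A.SalCat)

/-! ## The maps from the Salvetti complex to the complement -/

/-- The open convex subset `U(F, [G, C])` of the complement of the lifted arrangement, as a set of
pairs (real part, imaginary part). The real part runs over the face `G^` of the lifted arrangement
that is adjacent to the lift of `F` in the directions of `G`, and the imaginary part over the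
vectors on the same side as `C` of every element of `A[F]` that contains `G`. -/
def region (A : ToricArrangement d) (x : A.SalCat) : Set ((Fin d → ℝ) × (Fin d → ℝ)) :=
  {p | (∀ h ∈ A.lift,
          ((base x).rep.sgn h = 0 → side h p.1 = (fib x).face.sgn (h.1, 0)) ∧
          ((base x).rep.sgn h ≠ 0 → side h p.1 = (base x).rep.sgn h)) ∧
       ∀ h ∈ A.loc (base x), (fib x).face.sgn h = 0 → side h p.2 = (fib x).chamber.sgn h}

/-- A choice of one point in every set `U(F, [G, C])`. -/
def Points (A : ToricArrangement d) : Type :=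
  (x : A.SalCat) → {p : (Fin d → ℝ) × (Fin d → ℝ) // p ∈ A.region x}

theorem exists_gap (y : ℝ) : ∃ δ > 0, ∀ n : ℤ, (n : ℝ) ≠ y → δ ≤ |(n : ℝ) - y| := by
  have hc : IsClosed ((fun n : ℤ => (n : ℝ)) '' {n | (n : ℝ) ≠ y}) :=
    Int.isClosedEmbedding_coe_real.isClosedMap _ (isClosed_discrete _)
  have hy : y ∈ ((fun n : ℤ => (n : ℝ)) '' {n | (n : ℝ) ≠ y})ᶜ := by
    rintro ⟨n, hn, e⟩; exact hn e
  obtain ⟨δ, h0, hδ⟩ := Metric.isOpen_iff.1 hc.isOpen_compl y hy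
  refine ⟨δ, h0, fun n hn => ?_⟩
  by_contra! hlt
  exact hδ (show (n : ℝ) ∈ Metric.ball y δ by rwa [Metric.mem_ball, Real.dist_eq]) ⟨n, hn, rfl⟩

/-- The lifted arrangement is locally finite, in the form that is needed. -/
theorem eventually_lift (A : ToricArrangement d) (w k : Fin d → ℝ) :
    ∀ᶠ ε in nhdsWithin (0 : ℝ) (Set.Ioi 0), ∀ h ∈ A.lift, side h w ≠ 0 →
      side h (w + ε • k) = side h w := by
  have ev : ∀ᶠ ε in nhdsWithin (0 : ℝ) (Set.Ioi 0), ∀ c ∈ A.carrier, ∀ r : ℝ,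
      Circle.exp (2 * Real.pi * r) = c.2 → side (castVec c.1, r) w ≠ 0 →
      side (castVec c.1, r) (w + ε • k) = side (castVec c.1, r) w := by
    refine (Filter.eventually_all_finite A.finite).2 fun c _ => ?_
    by_cases hr0 : ∃ r0 : ℝ, Circle.exp (2 * Real.pi * r0) = c.2
    swap
    · exact Filter.Eventually.of_forall fun _ r hr => absurd ⟨r, hr⟩ hr0
    obtain ⟨r0, hr0⟩ := hr0
    obtain ⟨δ, hδ, hgap⟩ := exists_gap (castVec c.1 ⬝ᵥ w - r0)
    have hc : Continuous fun ε : ℝ => |ε * (castVec c.1 ⬝ᵥ k)| := by fun_prop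
    have ht := (hc.tendsto 0).mono_left (nhdsWithin_le_nhds (s := Set.Ioi (0 : ℝ)))
    simp only [zero_mul, abs_zero] at ht
    filter_upwards [ht.eventually_lt_const hδ] with ε hε r hr hne
    obtain ⟨n, hn⟩ := Circle.exp_eq_exp.1 (hr.trans hr0.symm)
    have hrn : r = r0 + n := by
      have hp : (2 * Real.pi) ≠ 0 := by positivity
      apply mul_left_cancel₀ hp
      rw [hn]; ring
    have hn' : (n : ℝ) ≠ castVec c.1 ⬝ᵥ w - r0 := by
      intro e
      apply hne
      rw [side_zero_iff, hrn, e]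
      ring
    have hg := hgap n hn'
    have key : (n : ℝ) - (castVec c.1 ⬝ᵥ w - r0) = -(castVec c.1 ⬝ᵥ w - r) := by rw [hrn]; ring
    rw [key, abs_neg] at hg
    simp only [side, dotProduct_add, dotProduct_smul, smul_eq_mul]
    have h2 := abs_lt.1 hε
    rcases lt_trichotomy (castVec c.1 ⬝ᵥ w - r) 0 with hb | hb | hb
    · rw [sign_neg hb, sign_neg]
      rw [abs_of_neg hb] at hg; linarith
    · rw [hb, abs_zero] at hg; linarith
    · rw [sign_pos hb, sign_pos]
      rw [abs_of_pos hb] at hg; linarith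
  filter_upwards [ev] with ε hε h hh
  obtain ⟨χ, h1, h2⟩ := hh
  have := hε _ h2 h.2 rfl
  rwa [show ((castVec χ, h.2) : Form d) = h from Prod.ext h1.symm rfl] at this

/-- Choices of points exist. -/
theorem points_nonempty (A : ToricArrangement d) : Nonempty A.Points := by
  refine ⟨fun x => Classical.choice ?_⟩
  obtain ⟨ε, hε, h0⟩ :=
    ((A.eventually_lift (base x).rep.pt (fib x).face.pt).and self_mem_nhdsWithin).exists
  refine ⟨⟨((base x).rep.pt + ε • (fib x).face.pt, (fib x).chamber.pt), fun h hh => ⟨fun hz => ?_,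
    fun hz => hε h hh hz⟩, fun h _ _ => rfl⟩⟩
  have e := (side_zero_iff _ _).1 hz
  simp only [Face.sgn, side, dotProduct_add, dotProduct_smul, e, smul_eq_mul]
  rw [add_sub_cancel_left, sub_zero, sign_mul, sign_pos (show 0 < ε from h0), one_mul]

/-- How the signs of the chosen points change along a morphism of `∫ 𝒟`. -/
theorem region_hom {A : ToricArrangement d} (ξ : A.Points) {x y : A.SalCat} (f : x ⟶ y)
    {h : Form d} (hh : h ∈ A.lift) :
    (side h (ξ y).1.1 = 0 ∨ side h (ξ y).1.1 = side h ((ξ x).1.1 + castVec (trans f))) ∧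
    (side h ((ξ x).1.1 + castVec (trans f)) = 0 →
      side (h.1, 0) (ξ y).1.2 = side (h.1, 0) (ξ x).1.2 ∧ side (h.1, 0) (ξ y).1.2 ≠ 0) := by
  let m : base y ⟶ base x := f.base.unop
  have hle : salMap m (fib x) ≤ fib y := leOfHom f.fiber
  have hs := A.shift_mem hh (trans f)
  have hx := (ξ x).2.1 _ hs
  have hy := (ξ y).2.1 _ hh
  rw [side_add]
  set h' : Form d := (h.1, h.2 - h.1 ⬝ᵥ castVec (trans f)) with hh'
  have hm : (base y).rep.sgn h = 0 ∨ (base y).rep.sgn h = (base x).rep.sgn h' := by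
    have := Face.le_iff.1 m.2 h hh
    rwa [translate_sgn _ _ _ hh] at this
  by_cases hby : (base y).rep.sgn h = 0
  · have hly : (h.1, (0 : ℝ)) ∈ A.loc (base y) := ⟨rfl, h.2, hh, hby⟩
    have hfy := hy.1 hby
    have hface := Face.le_iff.1 hle.1 _ hly
    by_cases hbx : (base x).rep.sgn h' = 0
    · have hlx : (h.1, (0 : ℝ)) ∈ A.loc (base x) := ⟨rfl, _, hs, hbx⟩
      have hfx := hx.1 hbx
      have e : (salMap m (fib x)).face.sgn (h.1, 0) = (fib x).face.sgn (h.1, 0) :=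
        faceMap_sgn m _ hlx
      rw [e] at hface
      refine ⟨?_, fun hz => ?_⟩
      · rw [hfy, hfx]; exact hface
      · rw [hfx] at hz
        have hz' : (fib x).face.sgn (h.1, 0) = 0 := hz
        have hzy : (fib y).face.sgn (h.1, 0) = 0 := by
          rcases hface with e | e
          · exact e
          · rw [e, hz']
        have e1 := (ξ x).2.2 _ hlx hz'
        have e2 := (ξ y).2.2 _ hly hzy
        have e3 := hle.2 _ hly (by rw [e, hz'])
        have e4 : (salMap m (fib x)).chamber.sgn (h.1, 0) = (fib x).chamber.sgn (h.1, 0) :=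
          faceMap_sgn m _ hlx
        rw [e1, e2, e3, e4]
        exact ⟨rfl, (fib x).isChamber _ hlx⟩
    · have hfx := hx.2 hbx
      refine ⟨?_, fun hz => absurd (hfx.symm.trans hz) hbx⟩
      have hnx : (h.1, (0 : ℝ)) ∉ A.loc (base x) := by
        intro hc
        have := (loc_sub m hc).2
        rw [side_dir m (h := (h.1, 0)) rfl hby hh, translate_sgn _ _ _ hh] at this
        exact hbx this
      have e : (salMap m (fib x)).face.sgn (h.1, 0) = side (h.1, 0) (dir m) :=
        faceMap_sgn' m _ hly hnx
      rw [e, side_dir m (h := (h.1, 0)) rfl hby hh, translate_sgn _ _ _ hh] at hface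
      rw [hfy, hfx]; exact hface
  · have e := hm.resolve_left hby
    have hbx : (base x).rep.sgn h' ≠ 0 := e ▸ hby
    have hfx := hx.2 hbx
    have hfy := hy.2 hby
    refine ⟨Or.inr (by rw [hfx, hfy, e]), fun hz => absurd (hfx.symm.trans hz) hbx⟩

/-- The translation that moves the chosen lift of the `i`-th vertex of a simplex of the nerve to
the lift that is compatible with the chosen lift of the last vertex. -/
def vtrans {A : ToricArrangement d} {n : ℕ} (σ : ComposableArrows A.SalCat n) (i : Fin (n + 1)) :
    Fin d → ℤ :=
  trans (σ.map (homOfLE (Fin.le_last i)))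

/-- The point with barycentric coordinates `t` of the affine simplex in `ℂ^d` that is spanned by
the compatible lifts of the points chosen for the vertices of `σ`. -/
noncomputable def simplexPt {A : ToricArrangement d} (ξ : A.Points) {n : ℕ}
    (σ : ComposableArrows A.SalCat n) (t : stdSimplex ℝ (Fin (n + 1))) : Fin d → ℂ :=
  cpt (∑ i, t i • ((ξ (σ.obj i)).1.1 + castVec (vtrans σ i))) (∑ i, t i • (ξ (σ.obj i)).1.2)

theorem form_castVec (χ : Fin d → ℤ) (x y : Fin d → ℝ) :
    ∑ j, (χ j : ℂ) * cpt x y j =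
      ((castVec χ ⬝ᵥ x : ℝ) : ℂ) + ((castVec χ ⬝ᵥ y : ℝ) : ℂ) * Complex.I := by
  simp only [dotProduct, cpt, castVec, Complex.ofReal_sum, Finset.sum_mul, ← Finset.sum_add_distrib]
  refine Finset.sum_congr rfl fun j _ => ?_
  push_cast; ring

theorem torusExp_mem_compl (A : ToricArrangement d) (x y : Fin d → ℝ)
    (H : ∀ h ∈ A.lift, h.1 ⬝ᵥ x = h.2 → h.1 ⬝ᵥ y ≠ 0) : torusExp (cpt x y) ∈ A.compl := by
  intro c hc hmem
  have e1 : Complex.exp (2 * Real.pi * Complex.I * ∑ j, (c.1 j : ℂ) * cpt x y j) = (c.2 : ℂ) := by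
    rw [← show _ = (c.2 : ℂ) from hmem, Finset.mul_sum, Complex.exp_sum, Units.coe_prod]
    refine Finset.prod_congr rfl fun j _ => ?_
    simp only [torusExp, Units.val_zpow_eq_zpow_val, Units.val_mk0]
    rw [← Complex.exp_int_mul]
    congr 1; ring
  rw [form_castVec] at e1
  set p := castVec c.1 ⬝ᵥ x
  set q := castVec c.1 ⬝ᵥ y with hq
  have hsplit : 2 * (Real.pi : ℂ) * Complex.I * ((p : ℂ) + (q : ℂ) * Complex.I) =
      ((-(2 * Real.pi * q) : ℝ) : ℂ) + ((2 * Real.pi * p : ℝ) : ℂ) * Complex.I := by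
    push_cast
    linear_combination (2 * (Real.pi : ℂ) * q) * Complex.I_mul_I
  rw [hsplit] at e1
  have hn := congrArg norm e1
  rw [Complex.norm_exp, Circle.norm_coe] at hn
  have hq0 : q = 0 := by
    have h1 : -(2 * Real.pi * q) = 0 := by
      have := Real.exp_eq_one_iff _ |>.1 hn
      simpa using this
    have hp : (2 * Real.pi) ≠ 0 := by positivity
    exact (mul_eq_zero.1 (neg_eq_zero.1 h1)).resolve_left hp
  refine H (castVec c.1, p) ⟨c.1, rfl, ?_⟩ rfl hq0
  have : Circle.exp (2 * Real.pi * p) = c.2 := by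
    apply Circle.ext
    rw [Circle.coe_exp, ← e1, hq0]
    simp
  rw [this]; exact hc

theorem vtrans_le {A : ToricArrangement d} {n : ℕ} (σ : ComposableArrows A.SalCat n)
    {i j : Fin (n + 1)} (hij : i ≤ j) :
    vtrans σ i = vtrans σ j + trans (σ.map (homOfLE hij)) := by
  rw [vtrans, vtrans, ← trans_comp, ← σ.map_comp]
  rfl

/-- A positive combination of numbers of the same non-zero sign does not vanish. -/
theorem sum_ne_zero_of_sign {n : ℕ} (t : stdSimplex ℝ (Fin (n + 1))) (f : Fin (n + 1) → ℝ)
    {s : SignType} (hs : s ≠ 0) (H : ∀ i, 0 < t i → SignType.sign (f i) = s ∨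
      SignType.sign (f i) = 0) (hex : ∃ i, 0 < t i ∧ SignType.sign (f i) = s) :
    ∑ i, t i * f i ≠ 0 := by
  obtain ⟨i₀, hi₀, hf₀⟩ := hex
  rcases s with _ | _ | _
  · exact absurd rfl hs
  · refine (Finset.sum_neg' (fun i _ => ?_) ⟨i₀, Finset.mem_univ _, ?_⟩).ne
    · rcases (stdSimplex.zero_le t i).lt_or_eq with h | h
      · rcases H i h with e | e
        · exact mul_nonpos_of_nonneg_of_nonpos h.le (sign_eq_neg_one_iff.1 e).le
        · rw [sign_eq_zero_iff.1 e, mul_zero]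
      · rw [← h, zero_mul]
    · exact mul_neg_of_pos_of_neg hi₀ (sign_eq_neg_one_iff.1 hf₀)
  · refine (Finset.sum_pos' (fun i _ => ?_) ⟨i₀, Finset.mem_univ _, ?_⟩).ne'
    · rcases (stdSimplex.zero_le t i).lt_or_eq with h | h
      · rcases H i h with e | e
        · exact mul_nonneg h.le (sign_eq_one_iff.1 e).le
        · rw [sign_eq_zero_iff.1 e, mul_zero]
      · rw [← h, zero_mul]
    · exact mul_pos hi₀ (sign_eq_one_iff.1 hf₀)

theorem dot_sum {n : ℕ} (α : Fin d → ℝ) (t : stdSimplex ℝ (Fin (n + 1)))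
    (v : Fin (n + 1) → Fin d → ℝ) : α ⬝ᵥ (∑ i, t i • v i) = ∑ i, t i * (α ⬝ᵥ v i) := by
  rw [dotProduct_sum]
  exact Finset.sum_congr rfl fun i _ => by rw [dotProduct_smul, smul_eq_mul]

/-- The affine simplices lie in the complement. -/
theorem simplexPt_mem {A : ToricArrangement d} (ξ : A.Points) {n : ℕ}
    (σ : ComposableArrows A.SalCat n) (t : stdSimplex ℝ (Fin (n + 1))) :
    torusExp (simplexPt ξ σ t) ∈ A.compl := by
  refine torusExp_mem_compl A _ _ fun h hh hre => ?_
  have hsum : ∑ i, t i = 1 := t.2.2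
  set g : Fin (n + 1) → Fin d → ℝ := fun i => (ξ (σ.obj i)).1.1 + castVec (vtrans σ i) with hg
  set v : Fin (n + 1) → Fin d → ℝ := fun i => (ξ (σ.obj i)).1.2 with hv
  have hre' : ∑ i, t i * (h.1 ⬝ᵥ g i - h.2) = 0 := by
    simp only [mul_sub, Finset.sum_sub_distrib, ← Finset.sum_mul, hsum, one_mul]
    rw [← dot_sum, hre, sub_self]
  have hchain : ∀ i j : Fin (n + 1), i ≤ j →
      (side h (g j) = 0 ∨ side h (g j) = side h (g i)) ∧
      (side h (g i) = 0 → side (h.1, 0) (v j) = side (h.1, 0) (v i) ∧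
        side (h.1, 0) (v j) ≠ 0) := by
    intro i j hij
    have := region_hom ξ (σ.map (homOfLE hij)) (A.shift_mem hh (vtrans σ j))
    rw [← side_add, ← side_add, add_assoc, ← castVec_add, add_comm (trans _),
      ← vtrans_le σ hij] at this
    exact this
  obtain ⟨i₀, hi₀, hmin⟩ : ∃ i, 0 < t i ∧ ∀ j, 0 < t j → i ≤ j := by
    have hne : (Finset.univ.filter fun i => 0 < t i).Nonempty := by
      by_contra hc
      rw [Finset.not_nonempty_iff_eq_empty, Finset.filter_eq_empty_iff] at hc
      have : ∑ i, t i ≤ 0 := Finset.sum_nonpos fun i hi => not_lt.1 (hc hi)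
      linarith
    refine ⟨_, (Finset.mem_filter.1 (Finset.min'_mem _ hne)).2, fun j hj => ?_⟩
    exact Finset.min'_le _ j (Finset.mem_filter.2 ⟨Finset.mem_univ _, hj⟩)
  by_cases hz : side h (g i₀) = 0
  · rw [dot_sum]
    have hs : ∀ i, SignType.sign (h.1 ⬝ᵥ v i) = side (h.1, 0) (v i) := fun i => by simp [side]
    refine sum_ne_zero_of_sign t _ (hchain i₀ i₀ le_rfl |>.2 hz).2 (fun i hi => Or.inl ?_)
      ⟨i₀, hi₀, hs _⟩
    rw [hs]; exact ((hchain i₀ i (hmin i hi)).2 hz).1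
  · refine absurd hre' (sum_ne_zero_of_sign t _ hz (fun i hi => ?_) ⟨i₀, hi₀, rfl⟩)
    exact (hchain i₀ i (hmin i hi)).1.symm

theorem continuous_simplexPt {A : ToricArrangement d} (ξ : A.Points) {n : ℕ}
    (σ : ComposableArrows A.SalCat n) : Continuous (simplexPt ξ σ) := by
  have ht (i : Fin (n + 1)) : Continuous fun t : stdSimplex ℝ (Fin (n + 1)) => t i :=
    (continuous_apply i).comp continuous_subtype_val
  refine continuous_pi fun j => ?_
  simp only [simplexPt, cpt, Finset.sum_apply, Pi.smul_apply, smul_eq_mul]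
  refine (Complex.continuous_ofReal.comp ?_).add
    ((Complex.continuous_ofReal.comp ?_).mul continuous_const)
  · exact continuous_finsetSum _ fun i _ => (ht i).mul continuous_const
  · exact continuous_finsetSum _ fun i _ => (ht i).mul continuous_const

theorem continuous_torusExp : Continuous (torusExp : (Fin d → ℂ) → Torus d) := by
  refine continuous_pi fun j => ?_
  rw [Units.isEmbedding_val₀.continuous_iff]
  change Continuous fun z : Fin d → ℂ => Complex.exp (2 * Real.pi * Complex.I * z j)
  fun_prop

/-- The affine simplices, projected to the complement in the torus. -/
noncomputable def simplexMap {A : ToricArrangement d} (ξ : A.Points) {n : ℕ}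
    (σ : ComposableArrows A.SalCat n) : C(stdSimplex ℝ (Fin (n + 1)), A.compl) where
  toFun t := ⟨torusExp (simplexPt ξ σ t), simplexPt_mem ξ σ t⟩
  continuous_toFun := (continuous_torusExp.comp (continuous_simplexPt ξ σ)).subtype_mk _

theorem torusExp_add_int (z : Fin d → ℂ) (u : Fin d → ℤ) :
    torusExp (fun j => z j + (u j : ℂ)) = torusExp z := by
  funext j
  apply Units.ext
  simp only [torusExp, Units.val_mk0]
  rw [Complex.exp_eq_exp_iff_exists_int]
  exact ⟨u j, by ring⟩

theorem sum_stdSimplex_map {m n : ℕ} (θ : Fin (m + 1) → Fin (n + 1))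
    (t : stdSimplex ℝ (Fin (m + 1))) (f : Fin (n + 1) → Fin d → ℝ) :
    ∑ k, (stdSimplex.map θ t) k • f k = ∑ i, t i • f (θ i) := by
  simp only [stdSimplex.map_coe, FunOnFinite.linearMap_apply_apply, Finset.sum_smul]
  rw [← Finset.sum_fiberwise_of_maps_to (g := θ) (t := Finset.univ) (fun _ _ => Finset.mem_univ _)]
  refine Finset.sum_congr rfl fun k _ => Finset.sum_congr rfl fun i hi => ?_
  rw [(Finset.mem_filter.1 hi).2]

/-- The affine simplices are compatible with faces and degeneracies. -/
theorem simplexMap_natural {A : ToricArrangement d} (ξ : A.Points) {m n : ℕ}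
    (θ : Fin (m + 1) ⥤ Fin (n + 1)) (σ : ComposableArrows A.SalCat n)
    (t : stdSimplex ℝ (Fin (m + 1))) :
    simplexMap ξ (σ.whiskerLeft θ) t = simplexMap ξ σ (stdSimplex.map θ.obj t) := by
  apply Subtype.ext
  change torusExp (simplexPt ξ (σ.whiskerLeft θ) t) = torusExp _
  have hv (i : Fin (m + 1)) : vtrans σ (θ.obj i) = vtrans σ (θ.obj (Fin.last _)) +
      vtrans (σ.whiskerLeft θ) i :=
    vtrans_le σ (leOfHom (θ.map (homOfLE (Fin.le_last i))))
  rw [← torusExp_add_int (simplexPt ξ (σ.whiskerLeft θ) t) (vtrans σ (θ.obj (Fin.last _)))]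
  congr 1
  funext j
  simp only [simplexPt, sum_stdSimplex_map, cpt]
  have hsum : ∑ i, t i = 1 := t.2.2
  have : ∀ i, t i • ((ξ (σ.obj (θ.obj i))).1.1 + castVec (vtrans σ (θ.obj i))) =
      t i • ((ξ (σ.obj (θ.obj i))).1.1 + castVec (vtrans (σ.whiskerLeft θ) i)) +
      t i • castVec (vtrans σ (θ.obj (Fin.last _))) := fun i => by
    rw [hv i, castVec_add, ← smul_add]; congr 1; abel
  simp only [this, Finset.sum_add_distrib, ← Finset.sum_smul, hsum, one_smul, Pi.add_apply]
  simp only [castVec, Complex.ofReal_add, Complex.ofReal_intCast]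
  rw [add_right_comm]
  rfl

/-- The complement as a topological space. -/
noncomputable abbrev M (A : ToricArrangement d) : TopCat.{0} := TopCat.of A.compl

/-- The affine simplices, as a map from the nerve of `∫ 𝒟` to the singular complex. -/
noncomputable def toSing {A : ToricArrangement d} (ξ : A.Points) :
    nerve A.SalCat ⟶ TopCat.toSSet.obj A.M where
  app n := TypeCat.ofHom fun σ => (A.M.toSSetObjEquiv n).symm (simplexMap ξ σ)
  naturality m n θ := by
    ext σ
    apply (A.M.toSSetObjEquiv n).injective
    exact ContinuousMap.ext fun t =>
      simplexMap_natural ξ (SimplexCategory.toCat.map θ.unop).toFunctor σ t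

/-- The standard map `Sal(A) → M(A)`, for a choice `ξ` of points: the map that is affine (in the
universal covering `ℂ^d` of the torus) on every simplex, with the vertices going to the
points chosen. -/
noncomputable def incl {A : ToricArrangement d} (ξ : A.Points) : A.Sal ⟶ A.M :=
  (sSetTopAdj.homEquiv _ _).symm (toSing ξ)

/-! ## Subcomplexes and subarrangements -/

/-- The objects of the subcategory `𝒮_{L,F₀}` of `∫ 𝒟`: those `(F, [G, K])` with `F ⊆ L` and
`K = C_G` for a chamber `C` of `A[F]` whose closure contains `F₀`. -/
def inSub (A : ToricArrangement d) (L : Set (Torus d)) (F₀ : Face A.linArr) :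
    ObjectProperty A.SalCat := fun x =>
  (base x).points ⊆ L ∧ ∃ C : Face (A.loc (base x)), C.IsChamber ∧
    F₀.carrier ⊆ closure C.carrier ∧ (fib x).face.NotSep C (fib x).chamber

/-- The category `𝒮_{L,F₀}`, the Grothendieck construction of the subdiagram of `𝒟` on the faces
in `L` that is given by the subposets `𝒮^{F₀}(A[F])` of `𝒮(A[F])`. -/
abbrev SubCat (A : ToricArrangement d) (L : Set (Torus d)) (F₀ : Face A.linArr) : Type :=
  (A.inSub L F₀).FullSubcategory

/-- The inclusion of `𝒮_{L,F₀}` in `∫ 𝒟`. -/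
noncomputable abbrev subIncl (A : ToricArrangement d) (L : Set (Torus d)) (F₀ : Face A.linArr) :
    A.SubCat L F₀ ⥤ A.SalCat := (A.inSub L F₀).ι

/-- The linear hull of the face `F₀` is `X_L`. -/
def Supports (A : ToricArrangement d) (F₀ : Face A.linArr) (L : Set (Torus d)) : Prop :=
  (Submodule.span ℝ F₀.carrier : Set (Fin d → ℝ)) = A.dirSpace L

/-- The map of Salvetti complexes induced by a functor; it is simplicial, hence cellular. -/
noncomputable def realize {A A' : ToricArrangement d} (Ψ : A.SalCat ⥤ A'.SalCat) :
    A.Sal ⟶ A'.Sal := SSet.toTop.map (nerveMap Ψ)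

theorem compl_subset {A A' : ToricArrangement d} (h : A'.carrier ⊆ A.carrier) :
    A.compl ⊆ A'.compl := fun _ ht k hk => ht k (h hk)

/-- The inclusion `M(A) → M(A')` for a subarrangement `A'` of `A`. -/
noncomputable def complIncl {A A' : ToricArrangement d} (h : A'.carrier ⊆ A.carrier) : A.M ⟶ A'.M :=
  TopCat.ofHom ⟨Set.inclusion (compl_subset h), continuous_inclusion _⟩

end ToricArrangement

end ToricSal

/-!
Every cell of `A` lies in a unique cell of a subarrangement `A'`, because sign vectors restrict. The
functor `coarsening` sends an object `(F, [G, C])` to the cells containing `F`, `G` and `C`. The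
chosen lifts of `F` and of the face of `A'` containing it differ by a vector `F.shift A'` of `ℤ^d`,
and a morphism `u : F ⟶ G` goes to `F.shift A' + u - G.shift A'`. Functoriality rests on
`faceMap_coarsen`: passing to the containing cells commutes with the maps `i_m`. The point is that
of several parallel hyperplanes at most one passes through a given face, so a form of the smaller
local arrangement at `F` that belongs to `A[G]` comes from a hyperplane of `A'` through `G`.

The homotopy is a straight line in the universal covering. Up to the shift, the region of the
admissible points of an object is contained in the region of its image
(`region_subset_coarsening`), and regions are convex. Hence at every time the vertices of the moving
simplex are admissible for `A'`, and `torusExp_affinePt_mem` shows that the simplex avoids the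
hypertori of `A'`. These homotopies on simplices are natural, so they form a simplicial map from the
nerve to the singular complex of the space of paths in `M(A')`. Its adjoint is the homotopy
(`incl_homotopic`).

The smallest layer `L'` of `A'` containing a layer `L` is the component around `L` of the
intersection of all hypertori of `A'` that contain `L`. A face `F'` with support `L'` near `F` is
obtained by moving a point of `F` slightly in a generic direction of `X_{L'}`
(`exists_supports_of_mem_dirSpace`). For the restriction of the functor one has to see that `F'`
vanishes on every form of a local arrangement of `A'` at a face in `L` on which `F` vanishes. The
character of such a form is constant on `L` (`IsLayer.chr_eq`: it is locally constant, since near a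
point the equations of the layer are linear in logarithmic coordinates). So the hypertorus through
the face contains `L`, hence also `L'`, and the form vanishes on `X_{L'}`.
-/

namespace ToricSal

/-! ### Passing to the faces of a subarrangement -/

/-- The face of `ℋ'` through the chosen point of a face `F` of `ℋ`. For `ℋ' ⊆ ℋ` this is the face
of `ℋ'` that contains `F`. -/
noncomputable def Face.coarsen {d : ℕ} {ℋ : Arr d} (ℋ' : Arr d) (F : Face ℋ) : Face ℋ' :=
  Face.of ℋ' F.pt

theorem Face.coarsen_sgn {d : ℕ} {ℋ ℋ' : Arr d} (F : Face ℋ) {h : Form d} (hh : h ∈ ℋ') :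
    (F.coarsen ℋ').sgn h = F.sgn h :=
  Face.sgn_of _ hh

theorem Face.carrier_subset_coarsen {d : ℕ} {ℋ ℋ' : Arr d} (hℋ : ℋ' ⊆ ℋ) (F : Face ℋ) :
    F.carrier ⊆ (F.coarsen ℋ').carrier := fun x hx =>
  (Face.mem_iff _ x).2 fun h hh => by rw [Face.coarsen_sgn F hh, (F.mem_iff x).1 hx h (hℋ hh)]

theorem Face.coarsen_mono {d : ℕ} {ℋ ℋ' : Arr d} (hℋ : ℋ' ⊆ ℋ) {F G : Face ℋ} (hFG : F ≤ G) :
    F.coarsen ℋ' ≤ G.coarsen ℋ' :=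
  Face.le_iff.2 fun h hh => by
    rw [Face.coarsen_sgn F hh, Face.coarsen_sgn G hh]; exact Face.le_iff.1 hFG h (hℋ hh)

/-- The pair of the faces of a smaller arrangement that contain `G` and `C`. -/
noncomputable def SalPoset.coarsen {d : ℕ} {ℋ ℋ' : Arr d} (hℋ : ℋ' ⊆ ℋ) (x : SalPoset ℋ) :
    SalPoset ℋ' where
  face := x.face.coarsen ℋ'
  chamber := x.chamber.coarsen ℋ'
  isChamber h hh := by rw [Face.coarsen_sgn _ hh]; exact x.isChamber h (hℋ hh)
  le := Face.coarsen_mono hℋ x.le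

theorem SalPoset.coarsen_mono {d : ℕ} {ℋ ℋ' : Arr d} (hℋ : ℋ' ⊆ ℋ) :
    Monotone (SalPoset.coarsen hℋ) := fun x y hxy =>
  ⟨Face.coarsen_mono hℋ hxy.1, fun h hh h0 => by
    have h0' : (x.face.coarsen ℋ').sgn h = 0 := h0
    rw [Face.coarsen_sgn _ hh] at h0'
    change (y.chamber.coarsen ℋ').sgn h = (x.chamber.coarsen ℋ').sgn h
    rw [Face.coarsen_sgn _ hh, Face.coarsen_sgn _ hh]
    exact hxy.2 h (hℋ hh) h0'⟩

namespace ToricArrangement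

variable {d : ℕ} {A A' : ToricArrangement d}

theorem castVec_neg (u : Fin d → ℤ) : castVec (-u) = -castVec u := by
  ext j; simp [castVec]

theorem castVec_sub (u v : Fin d → ℤ) : castVec (u - v) = castVec u - castVec v := by
  ext j; simp [castVec]

theorem lift_mono (hsub : A'.carrier ⊆ A.carrier) : A'.lift ⊆ A.lift :=
  fun _ ⟨χ, h1, h2⟩ => ⟨χ, h1, hsub h2⟩

theorem translate_coarsen_mono (hsub : A'.carrier ⊆ A.carrier) {F G : Face A.lift}
    {u : Fin d → ℤ} (hFG : F ≤ A.translate u G) :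
    F.coarsen A'.lift ≤ A'.translate u (G.coarsen A'.lift) :=
  Face.le_iff.2 fun h hh => by
    rw [translate_sgn _ _ _ hh, Face.coarsen_sgn F hh, Face.coarsen_sgn G (A'.shift_mem hh u),
      ← translate_sgn _ _ _ (lift_mono hsub hh)]
    exact Face.le_iff.1 hFG h (lift_mono hsub hh)

/-- The toric face of `A'` that contains the toric face `F` of a larger arrangement. -/
noncomputable def ToricFace.coarsen (A' : ToricArrangement d) (F : A.ToricFace) : A'.ToricFace :=
  Quotient.mk A'.faceSetoid (F.rep.coarsen A'.lift)

theorem ToricFace.exists_shift (A' : ToricArrangement d) (F : A.ToricFace) :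
    ∃ w, (F.coarsen A').rep = A'.translate w (F.rep.coarsen A'.lift) :=
  Quotient.exact (Quotient.out_eq (F.coarsen A'))

/-- A translation relating the chosen lifts of `F` and of the face of `A'` that contains `F`. It is
not unique if `A'` is not essential. -/
noncomputable def ToricFace.shift (A' : ToricArrangement d) (F : A.ToricFace) : Fin d → ℤ :=
  (F.exists_shift A').choose

theorem ToricFace.coarsen_rep (A' : ToricArrangement d) (F : A.ToricFace) :
    (F.coarsen A').rep = A'.translate (F.shift A') (F.rep.coarsen A'.lift) :=
  (F.exists_shift A').choose_spec

theorem ToricFace.coarsen_rep_sgn (F : A.ToricFace) {h : Form d} (hh : h ∈ A'.lift) :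
    (F.coarsen A').rep.sgn h = F.rep.sgn (h.1, h.2 - h.1 ⬝ᵥ castVec (F.shift A')) := by
  rw [coarsen_rep, translate_sgn _ _ _ hh, Face.coarsen_sgn _ (A'.shift_mem hh _)]

theorem ToricFace.add_shift_mem (hsub : A'.carrier ⊆ A.carrier) (F : A.ToricFace)
    {x : Fin d → ℝ} (hx : x ∈ F.rep.carrier) :
    x + castVec (F.shift A') ∈ (F.coarsen A').rep.carrier := by
  rw [coarsen_rep, mem_translate, add_sub_cancel_right]
  exact Face.carrier_subset_coarsen (lift_mono hsub) _ hx

theorem ToricFace.mem_loc_coarsen (F : A.ToricFace) {h : Form d} :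
    h ∈ A'.loc (F.coarsen A') ↔
      h.2 = 0 ∧ ∃ r : ℝ, (h.1, r) ∈ A'.lift ∧ F.rep.sgn (h.1, r) = 0 := by
  refine and_congr_right fun _ => ⟨?_, ?_⟩
  · rintro ⟨r, hr, hs⟩
    rw [coarsen_rep_sgn F hr] at hs
    exact ⟨_, A'.shift_mem hr _, hs⟩
  · rintro ⟨r, hr, hs⟩
    have hm : (h.1, r + h.1 ⬝ᵥ castVec (F.shift A')) ∈ A'.lift := by
      have := A'.shift_mem hr (-F.shift A')
      simpa [castVec_neg] using this
    refine ⟨_, hm, ?_⟩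
    rw [coarsen_rep_sgn F hm]
    simpa using hs

theorem ToricFace.loc_coarsen_subset (hsub : A'.carrier ⊆ A.carrier) (F : A.ToricFace) :
    A'.loc (F.coarsen A') ⊆ A.loc F := fun _ hh =>
  let ⟨h0, r, hr, hs⟩ := F.mem_loc_coarsen.1 hh
  ⟨h0, r, lift_mono hsub hr, hs⟩

theorem torusExp_add_castVec (x y : Fin d → ℝ) (u : Fin d → ℤ) :
    torusExp (cpt (x + castVec u) y) = torusExp (cpt x y) := by
  rw [← torusExp_add_int (cpt x y) u]
  congr 1
  funext j
  simp only [cpt, Pi.add_apply, castVec, Complex.ofReal_add, Complex.ofReal_intCast]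
  ring

theorem ToricFace.points_subset_coarsen (hsub : A'.carrier ⊆ A.carrier) (F : A.ToricFace) :
    F.points ⊆ (F.coarsen A').points := by
  rintro _ ⟨x, hx, rfl⟩
  exact ⟨_, F.add_shift_mem hsub hx, (torusExp_add_castVec x 0 _).symm⟩

/-- The map on morphisms of the functor `ℱ(A) → ℱ(A')` that sends a face to the face containing
it. -/
noncomputable def ToricFace.coarsenHom (hsub : A'.carrier ⊆ A.carrier) {F G : A.ToricFace}
    (m : F ⟶ G) : F.coarsen A' ⟶ G.coarsen A' :=
  ⟨F.shift A' + m.1 - G.shift A', by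
    rw [coarsen_rep A' G, ← translate_add, sub_add_cancel, coarsen_rep A' F, translate_add]
    exact A'.translate_mono _ (translate_coarsen_mono hsub m.2)⟩

/-- A hyperplane through the face `F` that is parallel to a hyperplane through the translate of `G`
over `F` is equal to it. Hence it belongs to `A'` as soon as one of these does. -/
theorem ToricFace.mem_loc_coarsen_of_hom {F G : A.ToricFace} (m : F ⟶ G)
    {h : Form d} (hF : h ∈ A'.loc (F.coarsen A')) (hG : h ∈ A.loc G) :
    h ∈ A'.loc (G.coarsen A') := by
  obtain ⟨h0, r, hr, hs⟩ := F.mem_loc_coarsen.1 hF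
  refine G.mem_loc_coarsen.2 ⟨h0, _, A'.shift_mem hr m.1, ?_⟩
  have e := (loc_sub m hG).2
  rw [side_zero_iff, h0] at e
  simp only [Face.sgn] at hs ⊢
  rw [side_zero_iff] at hs ⊢
  simp only [dir, dotProduct_sub, dotProduct_add] at e hs ⊢
  linarith

/-- Passing to the containing faces of the local arrangements of `A'` commutes with the maps
`i_m`. -/
theorem faceMap_coarsen (hsub : A'.carrier ⊆ A.carrier) {F G : A.ToricFace} (m : F ⟶ G)
    (K : Face (A.loc G)) :
    faceMap (ToricFace.coarsenHom hsub m) (K.coarsen (A'.loc (G.coarsen A'))) =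
      (faceMap m K).coarsen (A'.loc (F.coarsen A')) := by
  refine Face.ext_sgn fun h hF => ?_
  rw [Face.coarsen_sgn _ hF]
  by_cases hG : h ∈ A'.loc (G.coarsen A')
  · rw [faceMap_sgn _ _ hG, Face.coarsen_sgn _ hG, faceMap_sgn m _ (G.loc_coarsen_subset hsub hG)]
  · have hG' : h ∉ A.loc G := fun hc => hG (ToricFace.mem_loc_coarsen_of_hom m hF hc)
    rw [faceMap_sgn' _ _ hF hG, faceMap_sgn' m _ (F.loc_coarsen_subset hsub hF) hG']
    obtain ⟨h0, r, hr, hs⟩ := hF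
    rw [side_dir _ h0 hs hr, translate_sgn _ _ _ hr, G.coarsen_rep_sgn (A'.shift_mem hr _)]
    rw [F.coarsen_rep_sgn hr] at hs
    have hr' := lift_mono hsub (A'.shift_mem hr (F.shift A'))
    rw [side_dir m h0 hs hr', translate_sgn _ _ _ hr']
    congr 2
    simp only [ToricFace.coarsenHom, castVec_sub, castVec_add, dotProduct_add, dotProduct_sub]
    ring

theorem salMap_coarsen (hsub : A'.carrier ⊆ A.carrier) {F G : A.ToricFace} (m : F ⟶ G)
    (x : SalPoset (A.loc G)) :
    salMap (ToricFace.coarsenHom hsub m) (x.coarsen (G.loc_coarsen_subset hsub)) =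
      (salMap m x).coarsen (F.loc_coarsen_subset hsub) :=
  SalPoset.ext (faceMap_coarsen hsub m x.face) (faceMap_coarsen hsub m x.chamber)

theorem salMap_coarsen_le (hsub : A'.carrier ⊆ A.carrier) {F G : A.ToricFace} {m : F ⟶ G}
    {x : SalPoset (A.loc G)} {y : SalPoset (A.loc F)} (hle : salMap m x ≤ y) :
    salMap (ToricFace.coarsenHom hsub m) (x.coarsen (G.loc_coarsen_subset hsub)) ≤
      y.coarsen (F.loc_coarsen_subset hsub) := by
  rw [salMap_coarsen]
  exact SalPoset.coarsen_mono _ hle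

/-! ### The functor between Salvetti categories -/

theorem salCat_hom_ext {x y : A.SalCat} {f g : x ⟶ y} (h : trans f = trans g) : f = g :=
  Grothendieck.ext f g (Quiver.Hom.unop_inj (Subtype.ext h))
    ((Preorder.subsingleton_hom (α := SalPoset _) _ _).elim _ _)

/-- The functor `∫ 𝒟(A) → ∫ 𝒟(A')` that sends each cell to the cell of `A'` containing it. -/
noncomputable def coarsening (hsub : A'.carrier ⊆ A.carrier) : A.SalCat ⥤ A'.SalCat where
  obj x := ⟨Opposite.op ((base x).coarsen A'), (fib x).coarsen ((base x).loc_coarsen_subset hsub)⟩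
  map {x y} f := ⟨(ToricFace.coarsenHom hsub f.base.unop).op,
    homOfLE (X := SalPoset (A'.loc ((base y).coarsen A')))
      (salMap_coarsen_le hsub (leOfHom f.fiber))⟩
  map_id x := salCat_hom_ext (by
    change (base x).shift A' + 0 - (base x).shift A' = 0
    simp)
  map_comp {x y z} f g := salCat_hom_ext (by
    rw [trans_comp]
    change (base z).shift A' + trans (f ≫ g) - (base x).shift A' =
      ((base z).shift A' + trans g - (base y).shift A') +
        ((base y).shift A' + trans f - (base x).shift A')
    rw [trans_comp]
    abel)

/-! ### Affine simplices with arbitrary admissible vertices -/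

/-- The sign conditions that define a region determine all signs of the real part, and those of
the imaginary part with respect to the hyperplanes through the real part. -/
theorem region_side {x : A.SalCat} {p q : (Fin d → ℝ) × (Fin d → ℝ)} (hp : p ∈ A.region x)
    (hq : q ∈ A.region x) {h : Form d} (hh : h ∈ A.lift) :
    side h p.1 = side h q.1 ∧ (side h p.1 = 0 → side (h.1, 0) p.2 = side (h.1, 0) q.2) := by
  by_cases h0 : (base x).rep.sgn h = 0
  · have e := (hp.1 h hh).1 h0
    refine ⟨e.trans ((hq.1 h hh).1 h0).symm, fun hz => ?_⟩
    have hl : (h.1, (0 : ℝ)) ∈ A.loc (base x) := ⟨rfl, h.2, hh, h0⟩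
    exact (hp.2 _ hl (e.symm.trans hz)).trans (hq.2 _ hl (e.symm.trans hz)).symm
  · have e := (hp.1 h hh).2 h0
    exact ⟨e.trans ((hq.1 h hh).2 h0).symm, fun hz => absurd (e.symm.trans hz) h0⟩

/-- The sign changes along a morphism of `∫ 𝒟`, for any points of the two regions. In contrast to
`region_hom`, different points may be taken for the same object. -/
theorem region_hom_of_mem {x y : A.SalCat} (f : x ⟶ y) {p q : (Fin d → ℝ) × (Fin d → ℝ)}
    (hp : p ∈ A.region x) (hq : q ∈ A.region y) {h : Form d} (hh : h ∈ A.lift) :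
    (side h q.1 = 0 ∨ side h q.1 = side h (p.1 + castVec (trans f))) ∧
    (side h (p.1 + castVec (trans f)) = 0 →
      side (h.1, 0) q.2 = side (h.1, 0) p.2 ∧ side (h.1, 0) q.2 ≠ 0) := by
  obtain ⟨ξ⟩ := A.points_nonempty
  obtain ⟨H1, H2⟩ := region_hom ξ f hh
  obtain ⟨p1, p2⟩ := region_side hp (ξ x).2 (A.shift_mem hh (trans f))
  obtain ⟨q1, q2⟩ := region_side hq (ξ y).2 hh
  rw [side_add] at H1 H2 ⊢
  rw [← p1, ← q1] at H1
  rw [← p1] at H2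
  refine ⟨H1, fun hz => ?_⟩
  have hqz : side h q.1 = 0 := by
    rcases H1 with e | e
    · exact e
    · rw [e, hz]
  rw [p2 hz, q2 hqz]
  exact H2 hz

/-- The point with barycentric coordinates `t` of the affine simplex whose vertices are the
translates, compatible with the simplex `σ` of the nerve, of the points `p i`. -/
noncomputable def affinePt {n : ℕ} (σ : ComposableArrows A.SalCat n)
    (p : Fin (n + 1) → (Fin d → ℝ) × (Fin d → ℝ)) (t : stdSimplex ℝ (Fin (n + 1))) :
    Fin d → ℂ :=
  cpt (∑ i, t i • ((p i).1 + castVec (vtrans σ i))) (∑ i, t i • (p i).2)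

theorem torusExp_affinePt_mem {n : ℕ} (σ : ComposableArrows A.SalCat n)
    {p : Fin (n + 1) → (Fin d → ℝ) × (Fin d → ℝ)} (hp : ∀ i, p i ∈ A.region (σ.obj i))
    (t : stdSimplex ℝ (Fin (n + 1))) : torusExp (affinePt σ p t) ∈ A.compl := by
  refine torusExp_mem_compl A _ _ fun h hh hre => ?_
  have hsum : ∑ i, t i = 1 := t.2.2
  set g : Fin (n + 1) → Fin d → ℝ := fun i => (p i).1 + castVec (vtrans σ i)
  have hre' : ∑ i, t i * (h.1 ⬝ᵥ g i - h.2) = 0 := by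
    simp only [mul_sub, Finset.sum_sub_distrib, ← Finset.sum_mul, hsum, one_mul]
    rw [← dot_sum, hre, sub_self]
  have hchain : ∀ i j : Fin (n + 1), i ≤ j →
      (side h (g j) = 0 ∨ side h (g j) = side h (g i)) ∧
      (side h (g i) = 0 → side (h.1, 0) (p j).2 = side (h.1, 0) (p i).2 ∧
        side (h.1, 0) (p j).2 ≠ 0) := by
    intro i j hij
    have := region_hom_of_mem (σ.map (homOfLE hij)) (hp i) (hp j) (A.shift_mem hh (vtrans σ j))
    rw [← side_add, ← side_add, add_assoc, ← castVec_add, add_comm (trans _),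
      ← vtrans_le σ hij] at this
    exact this
  -- The first vertex of the face carrying `t` decides: either its real part is off the
  -- hyperplane `h`, and so is that of the point, or all the imaginary parts are on one side.
  obtain ⟨i₀, hi₀, hmin⟩ : ∃ i, 0 < t i ∧ ∀ j, 0 < t j → i ≤ j := by
    have hne : (Finset.univ.filter fun i => 0 < t i).Nonempty := by
      by_contra hc
      rw [Finset.not_nonempty_iff_eq_empty, Finset.filter_eq_empty_iff] at hc
      have : ∑ i, t i ≤ 0 := Finset.sum_nonpos fun i hi => not_lt.1 (hc hi)
      linarith
    refine ⟨_, (Finset.mem_filter.1 (Finset.min'_mem _ hne)).2, fun j hj => ?_⟩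
    exact Finset.min'_le _ j (Finset.mem_filter.2 ⟨Finset.mem_univ _, hj⟩)
  by_cases hz : side h (g i₀) = 0
  · rw [dot_sum]
    have hs : ∀ i, SignType.sign (h.1 ⬝ᵥ (p i).2) = side (h.1, 0) (p i).2 :=
      fun i => by simp [side]
    refine sum_ne_zero_of_sign t _ (hchain i₀ i₀ le_rfl |>.2 hz).2 (fun i hi => Or.inl ?_)
      ⟨i₀, hi₀, hs _⟩
    rw [hs]; exact ((hchain i₀ i (hmin i hi)).2 hz).1
  · refine absurd hre' (sum_ne_zero_of_sign t _ hz (fun i hi => ?_) ⟨i₀, hi₀, rfl⟩)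
    exact (hchain i₀ i (hmin i hi)).1.symm

theorem torusExp_affinePt_whiskerLeft {m n : ℕ} (θ : Fin (m + 1) ⥤ Fin (n + 1))
    (σ : ComposableArrows A.SalCat n) (p : Fin (n + 1) → (Fin d → ℝ) × (Fin d → ℝ))
    (t : stdSimplex ℝ (Fin (m + 1))) :
    torusExp (affinePt (σ.whiskerLeft θ) (fun i => p (θ.obj i)) t) =
      torusExp (affinePt σ p (stdSimplex.map θ.obj t)) := by
  have hv (i : Fin (m + 1)) : (p (θ.obj i)).1 + castVec (vtrans σ (θ.obj i)) =
      (p (θ.obj i)).1 + castVec (vtrans (σ.whiskerLeft θ) i) +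
        castVec (vtrans σ (θ.obj (Fin.last _))) := by
    have : vtrans σ (θ.obj i) = vtrans σ (θ.obj (Fin.last _)) + vtrans (σ.whiskerLeft θ) i :=
      vtrans_le σ (leOfHom (θ.map (homOfLE (Fin.le_last i))))
    rw [this, castVec_add]
    abel
  have hsum : ∑ i, t i = 1 := t.2.2
  rw [affinePt, ← torusExp_add_castVec _ _ (vtrans σ (θ.obj (Fin.last _))), affinePt,
    sum_stdSimplex_map, sum_stdSimplex_map]
  simp only [hv, smul_add, Finset.sum_add_distrib, ← Finset.sum_smul, hsum, one_smul]

/-! ### The homotopy -/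

theorem side_segment {h : Form d} {x y : Fin d → ℝ} (e : side h x = side h y)
    (s : unitInterval) : side h (x + (s : ℝ) • (y - x)) = side h y := by
  rcases s.2.1.eq_or_lt with h0 | h0
  · rw [← h0, zero_smul, add_zero, e]
  · exact side_convex h0 s.2.2 (Or.inr e)

/-- The regions are convex. -/
theorem segment_mem_region {x : A.SalCat} {p q : (Fin d → ℝ) × (Fin d → ℝ)}
    (hp : p ∈ A.region x) (hq : q ∈ A.region x) (s : unitInterval) :
    p + (s : ℝ) • (q - p) ∈ A.region x := by
  refine ⟨fun h hh => ?_, fun h hh h0 => ?_⟩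
  · change (_ → side h (p.1 + (s : ℝ) • (q.1 - p.1)) = _) ∧
      (_ → side h (p.1 + (s : ℝ) • (q.1 - p.1)) = _)
    rw [side_segment (region_side hp hq hh).1]
    exact hq.1 h hh
  · change side h (p.2 + (s : ℝ) • (q.2 - p.2)) = _
    rw [side_segment ((hp.2 h hh h0).trans (hq.2 h hh h0).symm)]
    exact hq.2 h hh h0

/-- Up to the translation between the chosen lifts, the region of an object of `∫ 𝒟(A)` is
contained in the region of its image. -/
theorem region_subset_coarsening (hsub : A'.carrier ⊆ A.carrier) {x : A.SalCat}
    {p : (Fin d → ℝ) × (Fin d → ℝ)} (hp : p ∈ A.region x) :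
    (p.1 + castVec ((base x).shift A'), p.2) ∈ A'.region ((coarsening hsub).obj x) := by
  refine ⟨fun h hh => ?_, fun h hh h0 => ?_⟩
  · have hs := A'.shift_mem hh ((base x).shift A')
    have hp' := hp.1 _ (lift_mono hsub hs)
    change (((base x).coarsen A').rep.sgn h = 0 → side h _ =
      ((fib x).face.coarsen (A'.loc ((base x).coarsen A'))).sgn (h.1, 0)) ∧
      (((base x).coarsen A').rep.sgn h ≠ 0 → side h _ = ((base x).coarsen A').rep.sgn h)
    refine ⟨fun h0 => ?_, fun h0 => ?_⟩
    · have hl : (h.1, (0 : ℝ)) ∈ A'.loc ((base x).coarsen A') := ⟨rfl, h.2, hh, h0⟩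
      rw [Face.coarsen_sgn _ hl, side_add]
      rw [ToricFace.coarsen_rep_sgn _ hh] at h0
      exact hp'.1 h0
    · rw [ToricFace.coarsen_rep_sgn _ hh] at h0 ⊢
      rw [side_add]
      exact hp'.2 h0
  · change h ∈ A'.loc ((base x).coarsen A') at hh
    change ((fib x).face.coarsen (A'.loc ((base x).coarsen A'))).sgn h = 0 at h0
    change side h p.2 = ((fib x).chamber.coarsen (A'.loc ((base x).coarsen A'))).sgn h
    rw [Face.coarsen_sgn _ hh] at h0 ⊢
    exact hp.2 h (ToricFace.loc_coarsen_subset hsub _ hh) h0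

/-- The segment from the point chosen for `x`, moved to the chosen lift of the face of `A'`, to the
point chosen for the image of `x`. -/
noncomputable def pathPt (hsub : A'.carrier ⊆ A.carrier) (ξ : A.Points) (ξ' : A'.Points)
    (s : unitInterval) (x : A.SalCat) : (Fin d → ℝ) × (Fin d → ℝ) :=
  ((ξ x).1.1 + castVec ((base x).shift A'), (ξ x).1.2) +
    (s : ℝ) • ((ξ' ((coarsening hsub).obj x)).1 -
      ((ξ x).1.1 + castVec ((base x).shift A'), (ξ x).1.2))

theorem pathPt_mem (hsub : A'.carrier ⊆ A.carrier) (ξ : A.Points) (ξ' : A'.Points)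
    (s : unitInterval) (x : A.SalCat) :
    pathPt hsub ξ ξ' s x ∈ A'.region ((coarsening hsub).obj x) :=
  segment_mem_region (region_subset_coarsening hsub (ξ x).2) (ξ' _).2 s

/-- The point at time `s`, with barycentric coordinates `t`, of the straight-line homotopy on a
simplex. -/
noncomputable def homotopyPt (hsub : A'.carrier ⊆ A.carrier) (ξ : A.Points) (ξ' : A'.Points)
    {n : ℕ} (σ : ComposableArrows A.SalCat n) (t : stdSimplex ℝ (Fin (n + 1)))
    (s : unitInterval) : Torus d :=
  torusExp (affinePt (σ ⋙ coarsening hsub) (fun i => pathPt hsub ξ ξ' s (σ.obj i)) t)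

theorem homotopyPt_mem (hsub : A'.carrier ⊆ A.carrier) (ξ : A.Points) (ξ' : A'.Points)
    {n : ℕ} (σ : ComposableArrows A.SalCat n) (t : stdSimplex ℝ (Fin (n + 1)))
    (s : unitInterval) : homotopyPt hsub ξ ξ' σ t s ∈ A'.compl :=
  torusExp_affinePt_mem (σ ⋙ coarsening hsub) (fun i => pathPt_mem hsub ξ ξ' s (σ.obj i)) t

theorem continuous_homotopyPt (hsub : A'.carrier ⊆ A.carrier) (ξ : A.Points)
    (ξ' : A'.Points) {n : ℕ} (σ : ComposableArrows A.SalCat n) :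
    Continuous fun z : stdSimplex ℝ (Fin (n + 1)) × unitInterval =>
      homotopyPt hsub ξ ξ' σ z.1 z.2 := by
  have ht (i : Fin (n + 1)) :
      Continuous fun z : stdSimplex ℝ (Fin (n + 1)) × unitInterval => z.1 i :=
    (continuous_apply i).comp (continuous_subtype_val.comp continuous_fst)
  have hp (i : Fin (n + 1)) : Continuous fun z : stdSimplex ℝ (Fin (n + 1)) × unitInterval =>
      pathPt hsub ξ ξ' z.2 (σ.obj i) :=
    continuous_const.add ((continuous_subtype_val.comp continuous_snd).smul continuous_const)
  refine continuous_torusExp.comp (continuous_pi fun j => ?_)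
  simp only [affinePt, cpt, Finset.sum_apply, Pi.smul_apply, smul_eq_mul, Pi.add_apply]
  refine (Complex.continuous_ofReal.comp ?_).add
    ((Complex.continuous_ofReal.comp ?_).mul continuous_const)
  · exact continuous_finsetSum _ fun i _ => (ht i).mul
      (((continuous_apply j).comp (continuous_fst.comp (hp i))).add continuous_const)
  · exact continuous_finsetSum _ fun i _ => (ht i).mul
      ((continuous_apply j).comp (continuous_snd.comp (hp i)))

/-- The straight-line homotopy on a simplex, as a map to the space of paths in the complement. -/
noncomputable def pathSimplex (hsub : A'.carrier ⊆ A.carrier) (ξ : A.Points) (ξ' : A'.Points)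
    {n : ℕ} (σ : ComposableArrows A.SalCat n) :
    C(stdSimplex ℝ (Fin (n + 1)), C(unitInterval, A'.compl)) :=
  ContinuousMap.curry
    ⟨fun z => ⟨homotopyPt hsub ξ ξ' σ z.1 z.2, homotopyPt_mem hsub ξ ξ' σ z.1 z.2⟩,
      (continuous_homotopyPt hsub ξ ξ' σ).subtype_mk _⟩

theorem pathSimplex_natural (hsub : A'.carrier ⊆ A.carrier) (ξ : A.Points) (ξ' : A'.Points)
    {m n : ℕ} (θ : Fin (m + 1) ⥤ Fin (n + 1)) (σ : ComposableArrows A.SalCat n)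
    (t : stdSimplex ℝ (Fin (m + 1))) :
    pathSimplex hsub ξ ξ' (σ.whiskerLeft θ) t =
      pathSimplex hsub ξ ξ' σ (stdSimplex.map θ.obj t) :=
  ContinuousMap.ext fun s => Subtype.ext <|
    torusExp_affinePt_whiskerLeft θ (σ ⋙ coarsening hsub)
      (fun i => pathPt hsub ξ ξ' s (σ.obj i)) t

theorem pathSimplex_zero (hsub : A'.carrier ⊆ A.carrier) (ξ : A.Points) (ξ' : A'.Points)
    {n : ℕ} (σ : ComposableArrows A.SalCat n) (t : stdSimplex ℝ (Fin (n + 1))) :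
    pathSimplex hsub ξ ξ' σ t 0 = Set.inclusion (compl_subset hsub) (simplexMap ξ σ t) := by
  apply Subtype.ext
  change torusExp (affinePt (σ ⋙ coarsening hsub) (fun i => pathPt hsub ξ ξ' 0 (σ.obj i)) t) =
    torusExp (simplexPt ξ σ t)
  have hv (i : Fin (n + 1)) : vtrans (σ ⋙ coarsening hsub) i =
      (base (σ.obj (Fin.last n))).shift A' + vtrans σ i - (base (σ.obj i)).shift A' := rfl
  have hsum : ∑ i, t i = 1 := t.2.2
  have e (i : Fin (n + 1)) : pathPt hsub ξ ξ' 0 (σ.obj i) =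
      ((ξ (σ.obj i)).1.1 + castVec ((base (σ.obj i)).shift A'), (ξ (σ.obj i)).1.2) := by
    simp [pathPt]
  rw [simplexPt, ← torusExp_add_castVec _ _ ((base (σ.obj (Fin.last n))).shift A'), affinePt]
  simp only [e, hv]
  congr 2
  simp only [castVec_add, castVec_sub, smul_add, smul_sub, Finset.sum_add_distrib,
    Finset.sum_sub_distrib, ← Finset.sum_smul, hsum, one_smul]
  abel

theorem pathSimplex_one (hsub : A'.carrier ⊆ A.carrier) (ξ : A.Points) (ξ' : A'.Points)
    {n : ℕ} (σ : ComposableArrows A.SalCat n) (t : stdSimplex ℝ (Fin (n + 1))) :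
    pathSimplex hsub ξ ξ' σ t 1 = simplexMap ξ' (σ ⋙ coarsening hsub) t := by
  apply Subtype.ext
  change torusExp (affinePt (σ ⋙ coarsening hsub) (fun i => pathPt hsub ξ ξ' 1 (σ.obj i)) t) =
    torusExp (simplexPt ξ' (σ ⋙ coarsening hsub) t)
  have e (i : Fin (n + 1)) : pathPt hsub ξ ξ' 1 (σ.obj i) =
      (ξ' ((σ ⋙ coarsening hsub).obj i)).1 := by
    simp [pathPt]
  simp only [affinePt, simplexPt, e]

/-- The space of paths in the complement. -/
noncomputable abbrev pathSpace (A : ToricArrangement d) : TopCat.{0} :=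
  TopCat.of C(unitInterval, A.compl)

/-- The end points of the paths in the complement. -/
noncomputable def pathEval (A : ToricArrangement d) (s : unitInterval) : A.pathSpace ⟶ A.M :=
  TopCat.ofHom ⟨fun γ => γ s, continuous_eval_const s⟩

/-- The straight-line homotopies on the simplices, as a map to the singular complex of the path
space. -/
noncomputable def toSingPath (hsub : A'.carrier ⊆ A.carrier) (ξ : A.Points) (ξ' : A'.Points) :
    nerve A.SalCat ⟶ TopCat.toSSet.obj A'.pathSpace where
  app n := TypeCat.ofHom fun σ => (A'.pathSpace.toSSetObjEquiv n).symm (pathSimplex hsub ξ ξ' σ)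
  naturality m n θ := by
    ext σ
    apply (A'.pathSpace.toSSetObjEquiv n).injective
    exact ContinuousMap.ext fun t =>
      pathSimplex_natural hsub ξ ξ' (SimplexCategory.toCat.map θ.unop).toFunctor σ t

theorem toSingPath_zero (hsub : A'.carrier ⊆ A.carrier) (ξ : A.Points) (ξ' : A'.Points) :
    toSingPath hsub ξ ξ' ≫ TopCat.toSSet.map (A'.pathEval 0) =
      toSing ξ ≫ TopCat.toSSet.map (complIncl hsub) := by
  ext n σ
  apply (A'.M.toSSetObjEquiv n).injective
  exact ContinuousMap.ext fun t => pathSimplex_zero hsub ξ ξ' σ t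

theorem toSingPath_one (hsub : A'.carrier ⊆ A.carrier) (ξ : A.Points) (ξ' : A'.Points) :
    toSingPath hsub ξ ξ' ≫ TopCat.toSSet.map (A'.pathEval 1) =
      nerveMap (coarsening hsub) ≫ toSing ξ' := by
  ext n σ
  apply (A'.M.toSSetObjEquiv n).injective
  exact ContinuousMap.ext fun t => pathSimplex_one hsub ξ ξ' σ t

/-- The standard maps are compatible with the functor up to homotopy. A homotopy is a map to the
path space, and by adjunction such a map can be given on each simplex of the nerve. -/
theorem incl_homotopic (hsub : A'.carrier ⊆ A.carrier) (ξ : A.Points) (ξ' : A'.Points) :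
    ContinuousMap.Homotopic (incl ξ ≫ complIncl hsub).hom
      (realize (coarsening hsub) ≫ incl ξ').hom := by
  set H : A.Sal ⟶ A'.pathSpace := (sSetTopAdj.homEquiv _ _).symm (toSingPath hsub ξ ξ') with hH
  have h0 : H ≫ A'.pathEval 0 = incl ξ ≫ complIncl hsub := by
    rw [hH, incl, ← Adjunction.homEquiv_naturality_right_symm, toSingPath_zero,
      Adjunction.homEquiv_naturality_right_symm]
  have h1 : H ≫ A'.pathEval 1 = realize (coarsening hsub) ≫ incl ξ' := by
    rw [hH, incl, realize, ← Adjunction.homEquiv_naturality_right_symm, toSingPath_one,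
      Adjunction.homEquiv_naturality_left_symm]
  refine ⟨⟨⟨fun z => H.hom z.2 z.1, ?_⟩, fun x => ?_, fun x => ?_⟩⟩
  · exact continuous_eval.comp
      ((H.hom.continuous.comp continuous_snd).prodMk continuous_fst)
  · rw [← h0]; rfl
  · rw [← h1]; rfl

end ToricArrangement

/-! ### Closures and convexity of faces -/

theorem Face.mem_closure_iff {d : ℕ} {ℋ : Arr d} (K : Face ℋ) (x : Fin d → ℝ) :
    x ∈ closure K.carrier ↔ ∀ h ∈ ℋ, side h x = 0 ∨ side h x = K.sgn h := by
  constructor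
  · intro hx h hh
    by_contra! hne
    have ho : IsOpen {y | side h y = side h x} := by
      rcases lt_trichotomy (h.1 ⬝ᵥ x - h.2) 0 with hb | hb | hb
      · simp only [side, sign_neg hb, sign_eq_neg_one_iff]
        exact isOpen_lt (continuous_form h) continuous_const
      · exact absurd (by rw [side, hb, sign_zero]) hne.1
      · simp only [side, sign_pos hb, sign_eq_one_iff]
        exact isOpen_lt continuous_const (continuous_form h)
    obtain ⟨y, hy, hyK⟩ := _root_.mem_closure_iff.1 hx _ ho rfl
    exact hne.2 (hy.symm.trans ((K.mem_iff y).1 hyK h hh))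
  · intro H
    have hle : Face.of ℋ x ≤ K := Face.le_iff.2 fun h hh => by
      rw [Face.sgn_of x hh]; exact H h hh
    exact hle (show x ∈ cell ℋ x from fun _ _ => rfl)

theorem Face.convex_carrier {d : ℕ} {ℋ : Arr d} (F : Face ℋ) : Convex ℝ F.carrier := by
  intro x hx y hy a b ha hb hab
  rw [F.mem_iff] at hx hy ⊢
  intro h hh
  have e : a • x + b • y = x + b • (y - x) := by
    rw [← eq_sub_iff_add_eq] at hab
    rw [hab, sub_smul, one_smul, smul_sub]; abel
  rw [e, ← hy h hh]
  exact ToricArrangement.side_segment ((hx h hh).trans (hy h hh).symm) ⟨b, hb, by linarith⟩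

namespace ToricArrangement

variable {d : ℕ} {A A' : ToricArrangement d}

/-! ### Characters and hypertori -/

/-- The character `t ↦ t^χ`. -/
noncomputable def chr (χ : Fin d → ℤ) (t : Torus d) : ℂˣ := ∏ j, t j ^ χ j

theorem chr_mul (χ : Fin d → ℤ) (s t : Torus d) : chr χ (s * t) = chr χ s * chr χ t := by
  simp [chr, mul_zpow, Finset.prod_mul_distrib]

theorem chr_torusExp (χ : Fin d → ℤ) (z : Fin d → ℂ) :
    (chr χ (torusExp z) : ℂ) = Complex.exp (2 * Real.pi * Complex.I * ∑ j, (χ j : ℂ) * z j) := by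
  rw [Finset.mul_sum, Complex.exp_sum, chr, Units.coe_prod]
  refine Finset.prod_congr rfl fun j _ => ?_
  simp only [torusExp, Units.val_zpow_eq_zpow_val, Units.val_mk0]
  rw [← Complex.exp_int_mul]
  congr 1; ring

theorem chr_torusExp_real (χ : Fin d → ℤ) (x : Fin d → ℝ) :
    (chr χ (torusExp (cpt x 0)) : ℂ) = Circle.exp (2 * Real.pi * (castVec χ ⬝ᵥ x)) := by
  rw [chr_torusExp, form_castVec, Circle.coe_exp]
  congr 1
  simp only [dotProduct_zero]
  push_cast
  ring

theorem mem_hypertorus (c : (Fin d → ℤ) × Circle) (t : Torus d) :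
    t ∈ hypertorus c ↔ (chr c.1 t : ℂ) = c.2 := Iff.rfl

theorem torusExp_mem_hypertorus (c : (Fin d → ℤ) × Circle) (x : Fin d → ℝ) :
    torusExp (cpt x 0) ∈ hypertorus c ↔ Circle.exp (2 * Real.pi * (castVec c.1 ⬝ᵥ x)) = c.2 := by
  rw [mem_hypertorus, chr_torusExp_real, Circle.ext_iff]

theorem ToricFace.isPreconnected_points (F : A.ToricFace) : IsPreconnected F.points := by
  have e : F.points = (fun x => torusExp (cpt x 0)) '' F.rep.carrier := by
    ext t; exact ⟨fun ⟨x, hx, h⟩ => ⟨x, hx, h.symm⟩, fun ⟨x, hx, h⟩ => ⟨x, hx, h.symm⟩⟩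
  rw [e]
  refine F.rep.convex_carrier.isPreconnected.image _ (Continuous.continuousOn ?_)
  refine continuous_torusExp.comp (continuous_pi fun j => ?_)
  simp only [cpt]
  fun_prop

/-- A hypertorus of the arrangement that meets a toric face contains it. -/
theorem ToricFace.points_subset_hypertorus (F : A.ToricFace) {c : (Fin d → ℤ) × Circle}
    (hc : c ∈ A.carrier) {t : Torus d} (ht : t ∈ F.points) (htc : t ∈ hypertorus c) :
    F.points ⊆ hypertorus c := by
  obtain ⟨x, hx, rfl⟩ := ht
  rintro _ ⟨y, hy, rfl⟩
  rw [torusExp_mem_hypertorus] at htc ⊢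
  have hm : (castVec c.1, castVec c.1 ⬝ᵥ x) ∈ A.lift := ⟨c.1, rfl, by rw [htc]; exact hc⟩
  have e : side (castVec c.1, castVec c.1 ⬝ᵥ x) y = side (castVec c.1, castVec c.1 ⬝ᵥ x) x :=
    ((F.rep.mem_iff y).1 hy _ hm).trans ((F.rep.mem_iff x).1 hx _ hm).symm
  rw [(side_zero_iff _ x).2 rfl, side_zero_iff] at e
  simp only at e
  rw [e, htc]

/-- Near `t`, every point of the torus is `t * torusExp z` for a small `z`. -/
theorem exists_local_log (t : Torus d) : ∃ ζ : Torus d → Fin d → ℂ,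
    (∀ s, s = t * torusExp (ζ s)) ∧ Filter.Tendsto ζ (nhds t) (nhds 0) := by
  have hp : (2 * (Real.pi : ℂ) * Complex.I) ≠ 0 := Complex.two_pi_I_ne_zero
  refine ⟨fun s j => Complex.log ((s j : ℂ) / (t j : ℂ)) / (2 * Real.pi * Complex.I),
    fun s => ?_, tendsto_pi_nhds.2 fun j => ?_⟩
  · funext j
    apply Units.ext
    simp only [Pi.mul_apply, Units.val_mul, torusExp, Units.val_mk0]
    rw [mul_div_cancel₀ _ hp, Complex.exp_log (div_ne_zero (s j).ne_zero (t j).ne_zero),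
      mul_div_cancel₀ _ (t j).ne_zero]
  · have h1 : ContinuousAt (fun s : Torus d => (s j : ℂ) / (t j : ℂ)) t :=
      ((Units.continuous_val.comp (continuous_apply j)).div_const _).continuousAt
    have e1 : ((t j : ℂ) / (t j : ℂ)) = 1 := div_self (t j).ne_zero
    have h2 : ContinuousAt Complex.log ((t j : ℂ) / (t j : ℂ)) := by
      rw [e1]; exact continuousAt_clog Complex.one_mem_slitPlane
    have h3 := (ContinuousAt.comp (f := fun s : Torus d => (s j : ℂ) / (t j : ℂ)) h2 h1).tendsto
    simpa [e1] using h3.div_const (2 * (Real.pi : ℂ) * Complex.I)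

/-! ### Layers -/

/-- The characters that cut out a layer `L` as a component already determine `X_L`: a vector
orthogonal to them is orthogonal to every character of a hypertorus containing `L`. -/
theorem mem_dirSpace_of_component {B : Set ((Fin d → ℤ) × Circle)} {t : Torus d}
    (ht : t ∈ ⋂ c ∈ B, hypertorus c) {v : Fin d → ℝ} (hv : ∀ c ∈ B, castVec c.1 ⬝ᵥ v = 0) :
    v ∈ A.dirSpace (connectedComponentIn (⋂ c ∈ B, hypertorus c) t) := by
  intro k _ hLk
  -- The one-parameter subgroup in the direction `v` stays in the layer.
  let γ : ℝ → Torus d := fun s => t * torusExp (cpt (s • v) 0)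
  have hγ : Continuous γ := by
    refine continuous_const.mul (continuous_torusExp.comp (continuous_pi fun j => ?_))
    simp only [cpt]
    fun_prop
  have hγ0 : γ 0 = t := by
    funext j; apply Units.ext; simp [γ, torusExp, cpt]
  have hγB : Set.range γ ⊆ ⋂ c ∈ B, hypertorus c := by
    rintro _ ⟨s, rfl⟩
    refine Set.mem_iInter₂.2 fun c hc => ?_
    rw [mem_hypertorus, chr_mul, Units.val_mul, chr_torusExp_real, dotProduct_smul, hv c hc]
    simpa using (mem_hypertorus c t).1 (Set.mem_iInter₂.1 ht c hc)
  have hγL := (isPreconnected_range hγ).subset_connectedComponentIn ⟨0, hγ0⟩ hγB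
  by_contra hne
  have hk (s : ℝ) : Circle.exp (2 * Real.pi * (s * (castVec k.1 ⬝ᵥ v))) = 1 := by
    have e1 : (chr k.1 (γ s) : ℂ) = k.2 := hLk (hγL ⟨s, rfl⟩)
    have e2 : (chr k.1 t : ℂ) = k.2 := hγ0 ▸ hLk (hγL ⟨0, rfl⟩)
    rw [chr_mul, Units.val_mul, chr_torusExp_real, ← e2, dotProduct_smul, smul_eq_mul] at e1
    exact Circle.ext ((mul_eq_left₀ (chr k.1 t).ne_zero).1 e1)
  have h1 := hk (1 / (2 * (castVec k.1 ⬝ᵥ v)))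
  have e : 2 * Real.pi * (1 / (2 * (castVec k.1 ⬝ᵥ v)) * (castVec k.1 ⬝ᵥ v)) = Real.pi := by
    field_simp
  rw [e] at h1
  have h2 := congrArg (fun z : Circle => (z : ℂ)) h1
  simp only [Circle.coe_exp, Complex.exp_pi_mul_I, Circle.coe_one] at h2
  norm_num at h2

/-- A character whose linear form vanishes on `X_L` is constant on the layer `L`. -/
theorem IsLayer.chr_eq {L : Set (Torus d)} (hL : A.IsLayer L) {χ : Fin d → ℤ}
    (hχ : ∀ v ∈ A.dirSpace L, castVec χ ⬝ᵥ v = 0) {s t : Torus d} (hs : s ∈ L) (ht : t ∈ L) :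
    chr χ s = chr χ t := by
  obtain ⟨B, hB, t₀, ht₀, rfl⟩ := hL
  refine isPreconnected_connectedComponentIn.induction₂ (fun s t => chr χ s = chr χ t)
    (fun x hx => ?_) (fun _ _ _ _ _ _ => Eq.trans) (fun _ _ _ _ => Eq.symm) hs ht
  obtain ⟨ζ, hζ, hζ0⟩ := exists_local_log x
  -- Logarithms of points of the layer that are close to `x` satisfy the linear equations of the
  -- layer, as these hold modulo `ℤ`.
  have ev : ∀ᶠ y in nhds x, ∀ c ∈ B, ‖∑ j, (c.1 j : ℂ) * ζ y j‖ < 1 := by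
    refine (Filter.eventually_all_finite (A.finite.subset hB)).2 fun c _ => ?_
    have hc : Continuous fun z : Fin d → ℂ => ‖∑ j, (c.1 j : ℂ) * z j‖ := by fun_prop
    have := (hc.tendsto 0).comp hζ0
    simp only [Pi.zero_apply, mul_zero, Finset.sum_const_zero, norm_zero] at this
    exact this.eventually_lt_const one_pos
  filter_upwards [mem_nhdsWithin_of_mem_nhds ev, self_mem_nhdsWithin] with y hy hyL
  have hsum (η : Fin d → ℤ) : ∑ j, (η j : ℂ) * ζ y j =
      ((castVec η ⬝ᵥ fun j => (ζ y j).re : ℝ) : ℂ) +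
        ((castVec η ⬝ᵥ fun j => (ζ y j).im : ℝ) : ℂ) * Complex.I := by
    rw [← form_castVec]
    refine Finset.sum_congr rfl fun j _ => ?_
    rw [cpt, Complex.re_add_im]
  have hmul (η : Fin d → ℤ) : (chr η y : ℂ) =
      chr η x * Complex.exp (2 * Real.pi * Complex.I * ∑ j, (η j : ℂ) * ζ y j) := by
    rw [← chr_torusExp, ← Units.val_mul, ← chr_mul, ← hζ y]
  have hB0 : ∀ c ∈ B, ∑ j, (c.1 j : ℂ) * ζ y j = 0 := by
    intro c hc
    have ex : (chr c.1 x : ℂ) = c.2 := Set.mem_iInter₂.1 (connectedComponentIn_subset _ _ hx) c hc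
    have ey : (chr c.1 y : ℂ) = c.2 := Set.mem_iInter₂.1 (connectedComponentIn_subset _ _ hyL) c hc
    have e := hmul c.1
    rw [ey, ← ex] at e
    have e1 := (mul_eq_left₀ (chr c.1 x).ne_zero).1 e.symm
    obtain ⟨n, hn⟩ := Complex.exp_eq_one_iff.1 e1
    have hn' : ∑ j, (c.1 j : ℂ) * ζ y j = n := by
      apply mul_left_cancel₀ Complex.two_pi_I_ne_zero
      rw [hn]; ring
    have hlt := hy c hc
    rw [hn', Complex.norm_intCast] at hlt
    have hn0 : n = 0 := Int.abs_lt_one_iff.1 (by exact_mod_cast hlt)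
    rw [hn', hn0, Int.cast_zero]
  have hre (c) (hc : c ∈ B) : (castVec c.1 ⬝ᵥ fun j => (ζ y j).re) = 0 := by
    have := congrArg Complex.re ((hsum c.1).symm.trans (hB0 c hc))
    simpa using this
  have him (c) (hc : c ∈ B) : (castVec c.1 ⬝ᵥ fun j => (ζ y j).im) = 0 := by
    have := congrArg Complex.im ((hsum c.1).symm.trans (hB0 c hc))
    simpa using this
  apply Units.ext
  rw [hmul χ, hsum χ, hχ _ (mem_dirSpace_of_component ht₀ hre),
    hχ _ (mem_dirSpace_of_component ht₀ him)]
  simp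

theorem IsLayer.subset_hypertorus {L : Set (Torus d)} (hL : A.IsLayer L)
    {c : (Fin d → ℤ) × Circle} (hc : ∀ v ∈ A.dirSpace L, castVec c.1 ⬝ᵥ v = 0) {t : Torus d}
    (ht : t ∈ L) (htc : t ∈ hypertorus c) : L ⊆ hypertorus c := fun s hs => by
  rw [mem_hypertorus, hL.chr_eq hc hs ht]
  exact htc

theorem IsLayer.isPreconnected {L : Set (Torus d)} (hL : A.IsLayer L) : IsPreconnected L := by
  obtain ⟨B, -, t, -, rfl⟩ := hL
  exact isPreconnected_connectedComponentIn

theorem IsLayer.nonempty {L : Set (Torus d)} (hL : A.IsLayer L) : L.Nonempty := by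
  obtain ⟨B, -, t, ht, rfl⟩ := hL
  exact ⟨t, mem_connectedComponentIn ht⟩

/-- A connected set that meets a layer and lies on all hypertori containing the layer is contained
in the layer. -/
theorem IsLayer.subset_of_isPreconnected {N S : Set (Torus d)} (hN : A.IsLayer N)
    (hS : IsPreconnected S) {s : Torus d} (hsS : s ∈ S) (hsN : s ∈ N)
    (H : ∀ c ∈ A.carrier, N ⊆ hypertorus c → S ⊆ hypertorus c) : S ⊆ N := by
  obtain ⟨B, hB, t, ht, rfl⟩ := hN
  rw [connectedComponentIn_eq hsN]
  refine hS.subset_connectedComponentIn hsS (Set.subset_iInter₂ fun c hc => H c (hB hc) ?_)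
  exact (connectedComponentIn_subset _ _).trans (Set.biInter_subset_of_mem hc)

/-- The smallest layer of `A'` containing a layer `L` is the component containing `L` of the
intersection of all hypertori of `A'` that contain `L`. -/
theorem IsLayer.exists_isLeast {L : Set (Torus d)} (hL : A.IsLayer L) (A' : ToricArrangement d) :
    ∃ L', IsLeast {N | A'.IsLayer N ∧ L ⊆ N} L' ∧
      ∀ c ∈ A'.carrier, L ⊆ hypertorus c → L' ⊆ hypertorus c := by
  obtain ⟨t, ht⟩ := hL.nonempty
  set B : Set ((Fin d → ℤ) × Circle) := {c | c ∈ A'.carrier ∧ L ⊆ hypertorus c}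
  have hLB : L ⊆ ⋂ c ∈ B, hypertorus c := Set.subset_iInter₂ fun c hc => hc.2
  have hsub : L ⊆ connectedComponentIn (⋂ c ∈ B, hypertorus c) t :=
    hL.isPreconnected.subset_connectedComponentIn ht hLB
  have hB : ∀ c ∈ A'.carrier, L ⊆ hypertorus c →
      connectedComponentIn (⋂ c ∈ B, hypertorus c) t ⊆ hypertorus c := fun c hc hLc =>
    (connectedComponentIn_subset _ _).trans (Set.biInter_subset_of_mem (show c ∈ B from ⟨hc, hLc⟩))
  refine ⟨_, ⟨⟨⟨B, fun c hc => hc.1, t, hLB ht, rfl⟩, hsub⟩, fun N hN => ?_⟩, hB⟩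
  exact hN.1.subset_of_isPreconnected isPreconnected_connectedComponentIn
    (hsub ht) (hN.2 ht) fun c hc hNc => hB c hc (hN.2.trans hNc)

/-! ### Faces with a given support -/

theorem linArr_mono (hsub : A'.carrier ⊆ A.carrier) : A'.linArr ⊆ A.linArr :=
  fun _ ⟨h0, c, hc, e⟩ => ⟨h0, c, hsub hc, e⟩

theorem linArr_finite (A : ToricArrangement d) : A.linArr.Finite := by
  refine (A.finite.image fun c => ((castVec c.1, 0) : Form d)).subset ?_
  rintro h ⟨h0, c, hc, e⟩
  exact ⟨c, hc, Prod.ext e.symm h0.symm⟩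

theorem loc_subset_linArr (F : A.ToricFace) : A.loc F ⊆ A.linArr :=
  fun _ ⟨h0, _, ⟨_, h1, h2⟩, _⟩ => ⟨h0, _, h2, h1⟩

/-- The subspace `X_L` as a submodule. -/
def dirSubmodule (A : ToricArrangement d) (L : Set (Torus d)) : Submodule ℝ (Fin d → ℝ) where
  carrier := A.dirSpace L
  zero_mem' := fun _ _ _ => dotProduct_zero _
  add_mem' := fun hv hw c hc hLc => by rw [dotProduct_add, hv c hc hLc, hw c hc hLc, add_zero]
  smul_mem' := fun a v hv c hc hLc => by rw [dotProduct_smul, hv c hc hLc, smul_zero]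

theorem dirSpace_mono (hsub : A'.carrier ⊆ A.carrier) {L L' : Set (Torus d)} (hL : L ⊆ L') :
    A.dirSpace L ⊆ A'.dirSpace L' := fun _ hv c hc hLc => hv c (hsub hc) (hL.trans hLc)

theorem Supports.carrier_subset {F : Face A.linArr} {L : Set (Torus d)} (hF : A.Supports F L) :
    F.carrier ⊆ A.dirSpace L := by
  rw [← hF]; exact Submodule.subset_span

/-- A form that vanishes at a point of a face vanishes on its support. -/
theorem Supports.dotProduct_eq_zero {F : Face A.linArr} {L : Set (Torus d)}
    (hF : A.Supports F L) {h : Form d} (hh : h ∈ A.linArr) (h0 : F.sgn h = 0) {v : Fin d → ℝ}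
    (hv : v ∈ A.dirSpace L) : h.1 ⬝ᵥ v = 0 := by
  rw [← hF] at hv
  refine Submodule.span_induction (p := fun v _ => h.1 ⬝ᵥ v = 0) (fun x hx => ?_)
    (dotProduct_zero _) (fun x y _ _ hx hy => ?_) (fun a x _ hx => ?_) hv
  · rw [(side_zero_iff h x).1 (((F.mem_iff x).1 hx h hh).trans h0), hh.1]
  · rw [dotProduct_add, hx, hy, add_zero]
  · rw [dotProduct_smul, hx, smul_zero]

theorem side_add_smul_of_zero {h : Form d} (h0 : h.2 = 0) {x k : Fin d → ℝ} (hx : side h x = 0)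
    {ε : ℝ} (hε : 0 < ε) : side h (x + ε • k) = side h k := by
  rw [side_zero_iff, h0] at hx
  rw [side, side, dotProduct_add, dotProduct_smul, hx, h0, smul_eq_mul, zero_add, sub_zero,
    sub_zero, sign_mul, sign_pos hε, one_mul]

theorem eventually_linArr (A : ToricArrangement d) (w k : Fin d → ℝ) :
    ∀ᶠ ε in nhdsWithin (0 : ℝ) (Set.Ioi 0), ∀ h ∈ A.linArr, side h w ≠ 0 →
      side h (w + ε • k) = side h w := by
  refine (Filter.eventually_all_finite A.linArr_finite).2 fun h _ => ?_
  by_cases h0 : side h w = 0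
  · exact Filter.Eventually.of_forall fun _ hn => absurd h0 hn
  · exact (eventually_side h w k h0).mono fun _ e _ => e

/-- Near every point of `X_L` there is a face of `A₀` with support `L`: move the point
slightly in a generic direction of `X_L`. -/
theorem exists_supports_of_mem_dirSpace (A : ToricArrangement d) {L : Set (Torus d)}
    {x : Fin d → ℝ} (hx : x ∈ A.dirSpace L) :
    ∃ F : Face A.linArr, A.Supports F L ∧ ∀ h ∈ A.linArr, side h x = 0 ∨ side h x = F.sgn h := by
  -- a vector `k` of `X_L` off all hyperplanes that do not contain `X_L`
  obtain ⟨k, hkX, hk⟩ : ∃ k ∈ A.dirSubmodule L, ∀ h ∈ A.linArr,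
      (∃ v ∈ A.dirSpace L, h.1 ⬝ᵥ v ≠ 0) → h.1 ⬝ᵥ k ≠ 0 := by
    let ι := {h : Form d // h ∈ A.linArr ∧ ∃ v ∈ A.dirSpace L, h.1 ⬝ᵥ v ≠ 0}
    have : Finite ι := (A.linArr_finite.subset (fun _ h => h.1)).to_subtype
    obtain ⟨k, hkX, hk⟩ := Module.Dual.exists_forall_mem_ne_zero_of_forall_exists
      (A.dirSubmodule L) (fun i : ι => dotProductBilin ℝ ℝ i.1.1) fun i => i.2.2
    exact ⟨k, hkX, fun h hh hv => hk ⟨h, hh, hv⟩⟩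
  obtain ⟨ε, hε, h0⟩ := ((A.eventually_linArr x k).and self_mem_nhdsWithin).exists
  have h0 : 0 < ε := h0
  set w := x + ε • k with hw
  have hwX : w ∈ A.dirSubmodule L := add_mem hx (Submodule.smul_mem _ _ hkX)
  have hw0 : ∀ h ∈ A.linArr, side h w = 0 → ∀ v ∈ A.dirSpace L, h.1 ⬝ᵥ v = 0 := by
    intro h hh hz
    by_contra! hne
    have hkne := hk h hh hne
    by_cases hxz : side h x = 0
    · rw [hw, side_add_smul_of_zero hh.1 hxz h0, side_zero_iff, hh.1] at hz
      exact hkne hz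
    · exact hxz ((hε h hh hxz).symm.trans hz)
  refine ⟨Face.of A.linArr w, ?_, fun h hh => ?_⟩
  · suffices hE : Submodule.span ℝ (Face.of A.linArr w).carrier = A.dirSubmodule L from
      congrArg (fun V : Submodule ℝ (Fin d → ℝ) => (V : Set (Fin d → ℝ))) hE
    refine le_antisymm (Submodule.span_le.2 fun y hy c hc hLc => ?_) fun v hv => ?_
    · have hh : ((castVec c.1, 0) : Form d) ∈ A.linArr := ⟨rfl, c, hc, rfl⟩
      have e : side (castVec c.1, 0) y = side (castVec c.1, 0) w := hy _ hh
      rw [(side_zero_iff _ w).2 (hwX c hc hLc), side_zero_iff] at e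
      exact e
    · obtain ⟨δ, hδ, hδ0⟩ := ((A.eventually_linArr w v).and self_mem_nhdsWithin).exists
      have hδ0 : 0 < δ := hδ0
      have hmem : w + δ • v ∈ (Face.of A.linArr w).carrier := by
        intro h hh
        by_cases hz : side h w = 0
        · rw [side_add_smul_of_zero hh.1 hz hδ0, hz, side_zero_iff, hh.1]
          exact hw0 h hh hz v hv
        · exact hδ h hh hz
      have hwmem : w ∈ (Face.of A.linArr w).carrier := fun _ _ => rfl
      have hsm := sub_mem (Submodule.subset_span (R := ℝ) hmem) (Submodule.subset_span hwmem)
      rw [add_sub_cancel_left] at hsm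
      simpa [smul_smul, inv_mul_cancel₀ hδ0.ne'] using Submodule.smul_mem _ δ⁻¹ hsm
  · by_cases hxz : side h x = 0
    · exact Or.inl hxz
    · right; rw [Face.sgn_of _ hh]; exact (hε h hh hxz).symm

/-! ### The functor on the subcategories of a layer -/

theorem exists_supports_closure (hsub : A'.carrier ⊆ A.carrier) {L L' : Set (Torus d)}
    (hLL : L ⊆ L') {F : Face A.linArr} (hF : A.Supports F L) :
    ∃ F' : Face A'.linArr, A'.Supports F' L' ∧ F.carrier ⊆ closure F'.carrier := by
  obtain ⟨F', hF', H⟩ := A'.exists_supports_of_mem_dirSpace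
    (dirSpace_mono hsub hLL (hF.carrier_subset F.pt_mem))
  refine ⟨F', hF', fun y hy => (F'.mem_closure_iff y).2 fun h hh => ?_⟩
  rw [(F.mem_iff y).1 hy h (linArr_mono hsub hh)]
  exact H h hh

/-- If a toric face of `A` lies in the layer `L`, then a form in the local arrangement of `A'` at
this face that vanishes on `X_L` vanishes on `X_{L'}`: its character is constant on `L`, so the
corresponding hypertorus contains `L` and therefore `L'`. -/
theorem mem_loc_coarsen_vanish {L L' : Set (Torus d)}
    (hL : A.IsLayer L) (hL' : ∀ c ∈ A'.carrier, L ⊆ hypertorus c → L' ⊆ hypertorus c)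
    {F : A.ToricFace} (hF : F.points ⊆ L) {h : Form d} (hh : h ∈ A'.loc (F.coarsen A'))
    (h0 : ∀ v ∈ A.dirSpace L, h.1 ⬝ᵥ v = 0) {v : Fin d → ℝ} (hv : v ∈ A'.dirSpace L') :
    h.1 ⬝ᵥ v = 0 := by
  obtain ⟨-, r, ⟨χ, h1, h2⟩, hs⟩ := F.mem_loc_coarsen.1 hh
  simp only at h1 h2
  have hs : h.1 ⬝ᵥ F.rep.pt = r := (side_zero_iff _ _).1 hs
  have htL : torusExp (cpt F.rep.pt 0) ∈ L := hF ⟨_, F.rep.pt_mem, rfl⟩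
  have htc : torusExp (cpt F.rep.pt 0) ∈ hypertorus (χ, Circle.exp (2 * Real.pi * r)) := by
    rw [torusExp_mem_hypertorus, ← hs, h1]
  rw [h1] at h0 ⊢
  exact hv _ h2 (hL' _ h2 (hL.subset_hypertorus h0 htL htc))

theorem ToricFace.points_coarsen_subset (hsub : A'.carrier ⊆ A.carrier) {L' : Set (Torus d)}
    (hL' : A'.IsLayer L') {F : A.ToricFace} (hF : F.points ⊆ L') :
    (F.coarsen A').points ⊆ L' := by
  have hp : torusExp (cpt F.rep.pt 0) ∈ F.points := ⟨_, F.rep.pt_mem, rfl⟩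
  have hp' := F.points_subset_coarsen hsub hp
  exact hL'.subset_of_isPreconnected (isPreconnected_points _) hp' (hF hp) fun c hc hLc =>
    points_subset_hypertorus _ hc hp' (hLc (hF hp))

/-- If `F` is in the closure of the chamber `C` of a local arrangement of `A`, then `F'` is in the
closure of the chamber containing `C` of the local arrangement of `A'`: on the latter, `F` and `F'`
have the same signs, since they vanish on the same forms. -/
theorem inSub_coarsening (hsub : A'.carrier ⊆ A.carrier) {L L' : Set (Torus d)}
    (hL : A.IsLayer L) (hlayer : A'.IsLayer L') (hLL : L ⊆ L')
    (hL' : ∀ c ∈ A'.carrier, L ⊆ hypertorus c → L' ⊆ hypertorus c)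
    {F : Face A.linArr} (hF : A.Supports F L) {F' : Face A'.linArr} (hF' : A'.Supports F' L')
    (hcl : F.carrier ⊆ closure F'.carrier) {x : A.SalCat} (hx : A.inSub L F x) :
    A'.inSub L' F' ((coarsening hsub).obj x) := by
  obtain ⟨hpts, C, hC, hFC, hsep⟩ := hx
  have hloc := (base x).loc_coarsen_subset hsub
  let C' : Face (A'.loc ((base x).coarsen A')) := C.coarsen _
  have hC' : C'.IsChamber := fun h hh => by
    rw [Face.coarsen_sgn C hh]
    exact hC h (hloc hh)
  have hFC' : F'.carrier ⊆ closure C'.carrier := fun y hy => (C'.mem_closure_iff y).2 fun h hh => by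
    have hlin : h ∈ A'.linArr := loc_subset_linArr _ hh
    rw [Face.coarsen_sgn C hh, (F'.mem_iff y).1 hy h hlin]
    have e1 : F.sgn h = 0 ∨ F.sgn h = F'.sgn h := (F'.mem_closure_iff _).1 (hcl F.pt_mem) h hlin
    have e2 : F.sgn h = 0 ∨ F.sgn h = C.sgn h :=
      (C.mem_closure_iff _).1 (hFC F.pt_mem) h (hloc hh)
    by_cases hz : F.sgn h = 0
    · left
      have hv := mem_loc_coarsen_vanish hL hL' hpts hh
        (fun v hv => hF.dotProduct_eq_zero (linArr_mono hsub hlin) hz hv)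
        (hF'.carrier_subset F'.pt_mem)
      rw [Face.sgn, side_zero_iff, hv, hlin.1]
    · right
      rw [← e1.resolve_left hz, e2.resolve_left hz]
  have hsep' : ((fib x).face.coarsen (A'.loc ((base x).coarsen A'))).NotSep C'
      ((fib x).chamber.coarsen _) := fun h hh h0 => by
    rw [Face.coarsen_sgn _ hh] at h0 ⊢
    rw [Face.coarsen_sgn _ hh]
    exact hsep h (hloc hh) h0
  exact ⟨(base x).points_coarsen_subset hsub hlayer (hpts.trans hLL), C', hC', hFC', hsep'⟩

end ToricArrangement
end ToricSal

theorem mainTheorem8 {d : ℕ} (A A' : ToricSal.ToricArrangement d)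
    (hsub : A'.carrier ⊆ A.carrier) (hrank : A'.rank = A.rank) :
    ∃ Ψ : A.SalCat ⥤ A'.SalCat,
      (∀ x : A.SalCat,
        (ToricSal.ToricArrangement.base x).points ⊆
          (ToricSal.ToricArrangement.base (Ψ.obj x)).points ∧
        (ToricSal.ToricArrangement.fib x).face.carrier ⊆
          (ToricSal.ToricArrangement.fib (Ψ.obj x)).face.carrier ∧
        (ToricSal.ToricArrangement.fib x).chamber.carrier ⊆
          (ToricSal.ToricArrangement.fib (Ψ.obj x)).chamber.carrier) ∧
      (∀ (ξ : A.Points) (ξ' : A'.Points),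
        ContinuousMap.Homotopic
          (ToricSal.ToricArrangement.incl ξ ≫ ToricSal.ToricArrangement.complIncl hsub).hom
          (ToricSal.ToricArrangement.realize Ψ ≫ ToricSal.ToricArrangement.incl ξ').hom) ∧
      ∀ L : Set (ToricSal.Torus d), A.IsLayer L →
        ∃ L' : Set (ToricSal.Torus d), IsLeast {N | A'.IsLayer N ∧ L ⊆ N} L' ∧
          ∀ F : ToricSal.Face A.linArr, A.Supports F L →
            (∃ F' : ToricSal.Face A'.linArr,
              A'.Supports F' L' ∧ F.carrier ⊆ closure F'.carrier) ∧
            ∀ F' : ToricSal.Face A'.linArr,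
              A'.Supports F' L' → F.carrier ⊆ closure F'.carrier →
              ∃ Φ : A.SubCat L F ⥤ A'.SubCat L' F',
                Φ ⋙ A'.subIncl L' F' = A.subIncl L F ⋙ Ψ := by
  refine ⟨ToricSal.ToricArrangement.coarsening hsub, fun x => ?_,
    ToricSal.ToricArrangement.incl_homotopic hsub, fun L hL => ?_⟩
  · have hloc := (ToricSal.ToricArrangement.base x).loc_coarsen_subset hsub
    exact ⟨(ToricSal.ToricArrangement.base x).points_subset_coarsen hsub,
      ToricSal.Face.carrier_subset_coarsen hloc _, ToricSal.Face.carrier_subset_coarsen hloc _⟩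
  · obtain ⟨L', hleast, hL'⟩ := hL.exists_isLeast A'
    refine ⟨L', hleast, fun F hF =>
      ⟨ToricSal.ToricArrangement.exists_supports_closure hsub hleast.1.2 hF,
        fun F' hF' hcl => ⟨CategoryTheory.ObjectProperty.lift _
          (A.subIncl L F ⋙ ToricSal.ToricArrangement.coarsening hsub) fun x => ?_, rfl⟩⟩⟩
    exact ToricSal.ToricArrangement.inSub_coarsening hsub hL hleast.1.1 hleast.1.2 hL' hF hF' hcl
      x.property
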